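/- Let $\alpha\ge 0$ be real, let $k\ge 1$ be an integer, and consider the linear ordinary differential equation $$EQ:\qquad a_k y^{(k)}+a_{k-1}y^{(k-1)}+\dots+a_0y=0,\qquad a_0,\dots,a_k\in\mathbb C,\ a_k\neq 0 .$$ Suppose that any two distinct roots of its characteristic polynomial $a_kX^k+\dots+a_1X+a_0$ have distinct real parts. Then there is a finite number $\sharp(EQ,\alpha)$, depending only on $\alpha$ and the equation, with the following two properties. 1. Every solution $y:\mathbb C\to\mathbb C$ of $EQ$ that is not identically zero has at most $\sharp(EQ,\alpha)$ zeros, counted with multiplicities, in the horizontal strip $\Pi_\alpha=\{z\in\mathbb C: |\operatorname{Im} z|\le\alpha\}$. 2. If all characteristic roots $\lambda_1,\dots,\lambda_k$ are simple, numbered so that $\operatorname{Re}\lambda_1<\operatorname{Re}\lambda_2<\dots<\operatorname{Re}\lambda_k$, then $$\sharp(EQ,\alpha)\le (k-1)^2+\frac{2}{\pi}(k-1)\,\mathcal L(EQ)\,\bigl[\alpha(\Xi+2)+\Theta\log 4\bigr],$$ where $\mathcal L(EQ)$ is the length of the shortest polygonal path in $\mathbb C$ passing through all the $\lambda_j$,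 and $$\Theta=\max_{1\le j\le k-1}\bigl|\operatorname{Re}\lambda_j-\operatorname{Re}\lambda_{j+1}\bigr|^{-1},\qquad \Xi=\max_{1\le j\le k-1}\left|\frac{\operatorname{Im}\lambda_j-\operatorname{Im}\lambda_{j+1}}{\operatorname{Re}\lambda_j-\operatorname{Re}\lambda_{j+1}}\right|$$ (both maxima are taken to be $0$ if $k=1$). -/

import Mathlib

open Polynomial

noncomputable section

/-- The characteristic polynomial `∑ a_j X ^ j` of the equation `∑ a_j y^(j) = 0`, `0 ≤ j ≤ k`. -/
def odeCharPoly {k : ℕ} (a : Fin (k + 1) → ℂ) : ℂ[X] :=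
  ∑ j : Fin (k + 1), C (a j) * X ^ (j : ℕ)

/-- `y` is an (entire) solution of `a_k y^(k) + ⋯ + a_1 y' + a_0 y = 0`. -/
def IsODESolution {k : ℕ} (a : Fin (k + 1) → ℂ) (y : ℂ → ℂ) : Prop :=
  Differentiable ℂ y ∧ ∀ z, ∑ j : Fin (k + 1), a j * iteratedDeriv (j : ℕ) y z = 0

/-- The closed horizontal strip `|Im z| ≤ α`. -/
def horizontalStrip (α : ℝ) : Set ℂ := {z | |z.im| ≤ α}

/-- The number of zeros of the analytic function `y` in `U`, counted with multiplicity: the sum over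
all `z ∈ U` of the order of vanishing of `y` at `z`, as the supremum of the finite partial sums. It
is `⊤` if there are infinitely many zeros. -/
def zeroCount (y : ℂ → ℂ) (U : Set ℂ) : ℕ∞ :=
  ⨆ (S : Finset ℂ) (_ : (S : Set ℂ) ⊆ U), ∑ z ∈ S, analyticOrderAt y z

/-- The set of points on the polygonal path with the given consecutive vertices. -/
def polygonalTrace : List ℂ → Set ℂ
  | [] => ∅
  | [z] => {z}
  | z :: w :: l => segment ℝ z w ∪ polygonalTrace (w :: l)

/-- The length of the polygonal path with the given consecutive vertices. -/
def polygonalLength : List ℂ → ℝ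
  | [] => 0
  | [_] => 0
  | z :: w :: l => dist z w + polygonalLength (w :: l)

/-- The length of the shortest polygonal path that passes through all points of `Λ`. -/
def shortestPathLength (Λ : Set ℂ) : ℝ :=
  sInf {ℓ | ∃ p : List ℂ, Λ ⊆ polygonalTrace p ∧ ℓ = polygonalLength p}

/-- `Θ = max_j |Re λ_j - Re λ_{j+1}|⁻¹` over consecutive indices (`0` if there are none). -/
def rootTheta {k : ℕ} (lam : Fin k → ℂ) : ℝ :=
  ⨆ j : Fin (k - 1),
    |(lam ⟨j, by omega⟩).re - (lam ⟨j + 1, by omega⟩).re|⁻¹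

/-- `Ξ = max_j |(Im λ_j - Im λ_{j+1}) / (Re λ_j - Re λ_{j+1})|` over consecutive indices
(`0` if there are none). -/
def rootXi {k : ℕ} (lam : Fin k → ℂ) : ℝ :=
  ⨆ j : Fin (k - 1),
    |((lam ⟨j, by omega⟩).im - (lam ⟨j + 1, by omega⟩).im) /
      ((lam ⟨j, by omega⟩).re - (lam ⟨j + 1, by omega⟩).re)|

end

/-! By the argument principle, the number of zeros of `f` in a rectangle is at most `1 / (2π)` times
the total variation `V f` of `arg f` along its boundary. A Rolle theorem holds for this variation:
`V f ≤ V f' + 2π`. Along a side with direction `u` and with `g = u f' / f`, the variation of `arg f`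
is `∫ |im g|` and that of `arg f'` is `∫ |im (g + g' / g)|`, and the latter exceeds the former by at
least the increment of `|arg g|`; the four right angles at the corners then cost `π / 2` each. If
`f` is annihilated by `(D - μ₁) ⋯ (D - μₖ)`, multiply by `e ^ (-μ₁ z)`, apply Rolle, and pass on to
`(D - μ₁) f`: replacing `e ^ (-μ₁ z)` by `e ^ (-μ₂ z)` costs `|μ₁ - μ₂|` times the perimeter, so all
steps together cost the length of the polygonal path through the roots `μ₁, …, μₖ`.

It remains to cover the zeros in the strip by boundedly many rectangles of bounded width. At a zero
of `∑ Pⱼ(z) e ^ (μⱼ z)` two terms have comparable size, and since their exponents have different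
real parts this confines `re z`. For constant `Pⱼ` the term that dominates changes at most `k - 1`
times as `re z` increases, and within the strip no zero is farther than `αΞ + Θ log 4` from such a
change, because beyond that distance the other terms decay like powers of `1 / 4`, which sum to less
than the dominant term. -/

section AngleRolle

open Complex Set Filter Topology

theorem abs_arg_mul_le {a b : ℂ} (ha : a ≠ 0) (hb : b ≠ 0) :
    |arg (a * b)| ≤ |arg a| + |arg b| := by
  have h := InnerProductGeometry.angle_le_angle_add_angle (a * b) b 1
  rw [angle_eq_abs_arg (mul_ne_zero ha hb) one_ne_zero, angle_eq_abs_arg (mul_ne_zero ha hb) hb,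
    angle_eq_abs_arg hb one_ne_zero] at h
  simpa only [div_one, mul_div_cancel_right₀ a hb] using h

theorem continuousAt_abs_arg {z : ℂ} (hz : z ≠ 0) : ContinuousAt (fun w => |arg w|) z := by
  have h : ContinuousAt (fun w : ℂ => InnerProductGeometry.angle w 1) z :=
    (InnerProductGeometry.continuousAt_angle (x := (z, (1 : ℂ))) hz one_ne_zero).comp
      (f := fun w : ℂ => (w, (1 : ℂ))) (by fun_prop)
  refine h.congr ?_
  filter_upwards [isOpen_ne.mem_nhds hz] with w hw
  rw [angle_eq_abs_arg hw one_ne_zero, div_one]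

theorem hasDerivAt_arg_comp {q : ℝ → ℂ} {q' : ℂ} {x : ℝ} (hq : HasDerivAt q q' x)
    (h : q x ∈ slitPlane) : HasDerivAt (fun t => arg (q t)) (q' / q x).im x := by
  simpa only [Function.comp_def, log_im, imCLM_apply] using
    imCLM.hasFDerivAt.comp_hasDerivAt x (hq.clog_real h)

theorem sign_arg_of_im_ne_zero {z : ℂ} (hz : z.im ≠ 0) :
    SignType.sign (arg z) = SignType.sign z.im := by
  rcases hz.lt_or_gt with h | h
  · rw [sign_neg h, sign_neg (arg_neg_iff.2 h)]
  · have harg : arg z ≠ 0 := fun h0 => h.ne' (arg_eq_zero_iff.1 h0).2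
    rw [sign_pos h, sign_pos ((arg_nonneg_iff.2 h.le).lt_of_ne' harg)]

theorem sign_mul_le_abs_add_sub_abs (a v : ℝ) : SignType.sign a * v ≤ |a + v| - |a| := by
  rcases lt_trichotomy a 0 with h | rfl | h
  · rw [sign_neg h, abs_of_neg h, SignType.coe_neg_one]
    linarith [neg_le_abs (a + v)]
  · simp
  · rw [sign_pos h, abs_of_pos h, SignType.coe_one]
    linarith [le_abs_self (a + v)]

theorem eventually_slope_abs_arg_lt_of_im_ne_zero {q : ℝ → ℂ} {q' : ℂ} {x : ℝ}
    (hq : HasDerivAt q q' x) (him : (q x).im ≠ 0) {r : ℝ}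
    (hr : |(q x).im + (q' / q x).im| - |(q x).im| < r) :
    ∀ᶠ t in 𝓝[>] x, slope (fun t => |arg (q t)|) x t < r := by
  have harg : arg (q x) ≠ 0 := fun h => him (arg_eq_zero_iff.1 h).2
  have hder := (hasDerivAt_abs harg).comp x (hasDerivAt_arg_comp hq (Or.inr him))
  rw [sign_arg_of_im_ne_zero him] at hder
  exact (hder.hasDerivWithinAt (s := Ioi x)).limsup_slope_le' self_notMem_Ioi
    ((sign_mul_le_abs_add_sub_abs _ _).trans_lt hr)

/- `|arg|` has a corner on the real axis, but `q t / q x` is near `1`, where `arg` is smooth. -/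
theorem eventually_slope_abs_arg_lt_of_abs_im_lt {q : ℝ → ℂ} {q' : ℂ} {x : ℝ}
    (hq : HasDerivAt q q' x) (h0 : q x ≠ 0) {r : ℝ} (hr : |(q' / q x).im| < r) :
    ∀ᶠ t in 𝓝[>] x, slope (fun t => |arg (q t)|) x t < r := by
  have hder := hasDerivAt_arg_comp (hq.div_const (q x)) (by simp [h0])
  rw [div_self h0, div_one] at hder
  have hne : ∀ᶠ t in 𝓝[>] x, q t ≠ 0 :=
    (hq.continuousAt.eventually_ne h0).filter_mono nhdsWithin_le_nhds
  filter_upwards [(hder.hasDerivWithinAt (s := Ioi x)).limsup_norm_slope_le hr, hne,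
    self_mem_nhdsWithin] with t ht hqt (hxt : x < t)
  refine lt_of_le_of_lt ?_ ht
  have hsub : |arg (q t)| - |arg (q x)| ≤ ‖arg (q t / q x) - arg (q x / q x)‖ := by
    have := abs_arg_mul_le (div_ne_zero hqt h0) h0
    rw [div_mul_cancel₀ _ h0] at this
    rw [div_self h0, arg_one, sub_zero, Real.norm_eq_abs]
    linarith
  rw [slope_def_field, div_eq_inv_mul, Real.norm_of_nonneg (sub_pos.2 hxt).le]
  gcongr

theorem eventually_slope_abs_arg_lt {q : ℝ → ℂ} {q' : ℂ} {x : ℝ} (hq : HasDerivAt q q' x)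
    (h0 : q x ≠ 0) {r : ℝ} (hr : |(q x).im + (q' / q x).im| - |(q x).im| < r) :
    ∀ᶠ t in 𝓝[>] x, slope (fun t => |arg (q t)|) x t < r := by
  by_cases him : (q x).im = 0
  · exact eventually_slope_abs_arg_lt_of_abs_im_lt hq h0 (by simpa [him] using hr)
  · exact eventually_slope_abs_arg_lt_of_im_ne_zero hq him hr

theorem abs_arg_sub_le_integral {q q' : ℝ → ℂ} {ℓ : ℝ} (hℓ : 0 ≤ ℓ)
    (hq : ∀ t, HasDerivAt q (q' t) t) (hq' : Continuous q') (h0 : ∀ t, q t ≠ 0) :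
    |arg (q ℓ)| - |arg (q 0)| ≤
      (∫ t in (0 : ℝ)..ℓ, |(q t).im + (q' t / q t).im|) - ∫ t in (0 : ℝ)..ℓ, |(q t).im| := by
  have hqc : Continuous q := continuous_iff_continuousAt.2 fun t => (hq t).continuousAt
  have hi₁ : Continuous fun t => |(q t).im + (q' t / q t).im| :=
    ((continuous_im.comp hqc).add (continuous_im.comp (hq'.div hqc h0))).abs
  have hi₂ : Continuous fun t => |(q t).im| := by fun_prop
  have hder (x : ℝ) : HasDerivAt
      (fun s => |arg (q 0)| + ∫ t in (0 : ℝ)..s, (|(q t).im + (q' t / q t).im| - |(q t).im|))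
      (|(q x).im + (q' x / q x).im| - |(q x).im|) x :=
    ((hi₁.sub hi₂).integral_hasStrictDerivAt 0 x).hasDerivAt.const_add _
  have hle := image_le_of_liminf_slope_right_le_deriv_boundary (a := 0) (b := ℓ)
    (f := fun t => |arg (q t)|)
    (fun x _ => ((continuousAt_abs_arg (h0 x)).comp hqc.continuousAt).continuousWithinAt)
    (by simp) (fun x _ => (hder x).continuousAt.continuousWithinAt)
    (fun x _ => (hder x).hasDerivWithinAt)
    (fun x _ r hr => (eventually_slope_abs_arg_lt (hq x) (h0 x) hr).frequently)
    (right_mem_Icc.2 hℓ)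
  rw [intervalIntegral.integral_sub (hi₁.intervalIntegrable _ _) (hi₂.intervalIntegrable _ _)]
    at hle
  linarith

end AngleRolle

section Variation

open Complex Set

/-- The total variation of `arg f` along the segment of length `ℓ` from `z` in the unit
direction `u`. -/
noncomputable def edgeVariation (f : ℂ → ℂ) (z u : ℂ) (ℓ : ℝ) : ℝ :=
  ∫ t in (0 : ℝ)..ℓ, |(u * logDeriv f (z + t * u)).im|

/-- The vertices of the rectangle with lower left corner `z`, width `w` and height `h`,
counterclockwise from `z`. The side that starts at vertex number `j` has the direction `I ^ j`. -/
noncomputable def rectVertex (z : ℂ) (w h : ℝ) : Fin 4 → ℂ :=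
  ![z, z + w, z + w + h * I, z + h * I]

/-- The side lengths of a rectangle, in the order of `rectVertex`. -/
def rectSide (w h : ℝ) : Fin 4 → ℝ :=
  ![w, h, w, h]

/-- The total variation of `arg f` along the boundary of the rectangle with lower left corner `z`,
width `w` and height `h`. -/
noncomputable def rectVariation (f : ℂ → ℂ) (z : ℂ) (w h : ℝ) : ℝ :=
  ∑ j : Fin 4, edgeVariation f (rectVertex z w h j) (I ^ (j : ℕ)) (rectSide w h j)

/-- The union of the four lines that carry the sides of a rectangle. Avoiding zeros on whole lines,
not only on the sides, keeps `logDeriv` continuous along the full parametrization of each side. -/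
def rectLines (z : ℂ) (w h : ℝ) : Set ℂ :=
  {ζ | ζ.re = z.re ∨ ζ.re = z.re + w ∨ ζ.im = z.im ∨ ζ.im = z.im + h}

theorem rectVertex_add_one (z : ℂ) (w h : ℝ) (j : Fin 4) :
    rectVertex z w h (j + 1) = rectVertex z w h j + rectSide w h j * I ^ (j : ℕ) := by
  fin_cases j <;> simp [rectVertex, rectSide, pow_succ]
  ring

theorem I_pow_val_add_one (j : Fin 4) : I ^ ((j + 1 : Fin 4) : ℕ) = I * I ^ (j : ℕ) := by
  fin_cases j <;> simp [pow_succ]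

theorem rectSide_nonneg {w h : ℝ} (hw : 0 ≤ w) (hh : 0 ≤ h) (j : Fin 4) : 0 ≤ rectSide w h j := by
  fin_cases j <;> simpa [rectSide]

theorem sum_rectSide (w h : ℝ) : ∑ j, rectSide w h j = 2 * w + 2 * h := by
  simp only [rectSide, Fin.sum_univ_four, Matrix.cons_val]
  ring

theorem rectVertex_add_mem_rectLines (z : ℂ) (w h : ℝ) (j : Fin 4) (t : ℝ) :
    rectVertex z w h j + t * I ^ (j : ℕ) ∈ rectLines z w h := by
  fin_cases j <;> simp [rectVertex, rectLines, pow_succ]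

theorem rectVertex_mem_rectLines (z : ℂ) (w h : ℝ) (j : Fin 4) :
    rectVertex z w h j ∈ rectLines z w h := by
  simpa using rectVertex_add_mem_rectLines z w h j 0

section Edge

variable {f : ℂ → ℂ} {z u : ℂ} {ℓ : ℝ}

theorem continuous_logDeriv_edge (hf : Differentiable ℂ f) (h0 : ∀ t : ℝ, f (z + t * u) ≠ 0) :
    Continuous fun t : ℝ => logDeriv f (z + t * u) := by
  simp only [logDeriv_apply]
  exact (hf.deriv.continuous.comp (by fun_prop)).div (hf.continuous.comp (by fun_prop)) h0

theorem hasDerivAt_logDeriv (hf : Differentiable ℂ f) (h0 : f z ≠ 0) (h1 : deriv f z ≠ 0) :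
    HasDerivAt (logDeriv f) (logDeriv f z * (logDeriv (deriv f) z - logDeriv f z)) z := by
  refine ((hf.deriv z).hasDerivAt.div (hf z).hasDerivAt h0).congr_deriv ?_
  simp only [logDeriv_apply]
  field_simp

theorem edgeVariation_le_deriv (hf : Differentiable ℂ f) (hℓ : 0 ≤ ℓ) (hu : u ≠ 0)
    (h0 : ∀ t : ℝ, f (z + t * u) ≠ 0) (h1 : ∀ t : ℝ, deriv f (z + t * u) ≠ 0) :
    edgeVariation f z u ℓ ≤ edgeVariation (deriv f) z u ℓ +
      (|arg (u * logDeriv f z)| - |arg (u * logDeriv f (z + ℓ * u))|) := by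
  set L : ℝ → ℂ := fun t => logDeriv f (z + t * u)
  set M : ℝ → ℂ := fun t => logDeriv (deriv f) (z + t * u)
  have hL : Continuous L := continuous_logDeriv_edge hf h0
  have hM : Continuous M := continuous_logDeriv_edge hf.deriv h1
  have hL0 (t : ℝ) : L t ≠ 0 := div_ne_zero (h1 t) (h0 t)
  have hder (t : ℝ) : HasDerivAt (fun t => u * L t) (u * (L t * (M t - L t) * u)) t := by
    have hline : HasDerivAt (fun t : ℝ => z + t * u) u t := by
      simpa using ((ofRealCLM.hasDerivAt (x := t)).mul_const u).const_add z
    exact ((hasDerivAt_logDeriv hf (h0 t) (h1 t)).comp t hline).const_mul u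
  have hle := abs_arg_sub_le_integral hℓ hder (by fun_prop) fun t => mul_ne_zero hu (hL0 t)
  have hsum (t : ℝ) : (u * L t).im + (u * (L t * (M t - L t) * u) / (u * L t)).im =
      (u * M t).im := by
    rw [← add_im]
    congr 1
    field_simp [hL0 t]
    ring
  simp only [hsum] at hle
  simp only [L, ofReal_zero, zero_mul, add_zero] at hle
  unfold edgeVariation
  linarith

theorem logDeriv_exp_mul (c : ℂ) (hf : DifferentiableAt ℂ f z) (h0 : f z ≠ 0) :
    logDeriv (fun ζ => exp (c * ζ) * f ζ) z = c + logDeriv f z := by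
  have hexp : HasDerivAt (fun ζ => exp (c * ζ)) (exp (c * z) * c) z := by
    simpa using ((hasDerivAt_id z).const_mul c).cexp
  rw [logDeriv_mul (f := fun ζ => exp (c * ζ)) z (exp_ne_zero _) h0 hexp.differentiableAt hf,
    logDeriv_apply, hexp.deriv, mul_div_cancel_left₀ _ (exp_ne_zero _)]

theorem edgeVariation_exp_mul_le (hf : Differentiable ℂ f) (hℓ : 0 ≤ ℓ) (hu : ‖u‖ = 1)
    (h0 : ∀ t : ℝ, f (z + t * u) ≠ 0) (c : ℂ) :
    edgeVariation (fun ζ => exp (c * ζ) * f ζ) z u ℓ ≤ ‖c‖ * ℓ + edgeVariation f z u ℓ := by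
  have hL := continuous_logDeriv_edge hf h0
  have hint {g : ℝ → ℝ} (hg : Continuous g) : IntervalIntegrable g MeasureTheory.volume 0 ℓ :=
    hg.intervalIntegrable _ _
  have hpt (t : ℝ) : |(u * (c + logDeriv f (z + t * u))).im| ≤
      ‖c‖ + |(u * logDeriv f (z + t * u)).im| := by
    rw [mul_add, add_im]
    refine (abs_add_le _ _).trans (add_le_add_left ((abs_im_le_norm _).trans ?_) _)
    rw [norm_mul, hu, one_mul]
  calc edgeVariation (fun ζ => exp (c * ζ) * f ζ) z u ℓ
      = ∫ t in (0 : ℝ)..ℓ, |(u * (c + logDeriv f (z + t * u))).im| := by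
        simp only [edgeVariation, logDeriv_exp_mul c (hf _) (h0 _)]
    _ ≤ ∫ t in (0 : ℝ)..ℓ, (‖c‖ + |(u * logDeriv f (z + t * u)).im|) :=
        intervalIntegral.integral_mono_on hℓ (hint (by fun_prop)) (hint (by fun_prop))
          fun t _ => hpt t
    _ = ‖c‖ * ℓ + edgeVariation f z u ℓ := by
        rw [intervalIntegral.integral_add (hint (by fun_prop)) (hint (by fun_prop)),
          intervalIntegral.integral_const, smul_eq_mul, sub_zero, mul_comm ℓ, edgeVariation]

end Edge

variable {f : ℂ → ℂ} {z : ℂ} {w h : ℝ}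

/-- Rolle's theorem for arguments: the four corners contribute `π / 2` each. -/
theorem rectVariation_le_deriv (hf : Differentiable ℂ f) (hw : 0 ≤ w) (hh : 0 ≤ h)
    (h0 : ∀ ζ ∈ rectLines z w h, f ζ ≠ 0) (h1 : ∀ ζ ∈ rectLines z w h, deriv f ζ ≠ 0) :
    rectVariation f z w h ≤ rectVariation (deriv f) z w h + 2 * Real.pi := by
  set start : Fin 4 → ℝ := fun j => |arg (I ^ (j : ℕ) * logDeriv f (rectVertex z w h j))|
  set finish : Fin 4 → ℝ := fun j => |arg (I ^ (j : ℕ) * logDeriv f (rectVertex z w h (j + 1)))|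
  have hedge (j : Fin 4) := edgeVariation_le_deriv hf (rectSide_nonneg hw hh j)
    (pow_ne_zero j I_ne_zero) (fun t => h0 _ (rectVertex_add_mem_rectLines z w h j t))
    (fun t => h1 _ (rectVertex_add_mem_rectLines z w h j t))
  simp only [← rectVertex_add_one] at hedge
  have hcorner (j : Fin 4) : start (j + 1) ≤ finish j + Real.pi / 2 := by
    have hmem := rectVertex_mem_rectLines z w h (j + 1)
    have hL : logDeriv f (rectVertex z w h (j + 1)) ≠ 0 := div_ne_zero (h1 _ hmem) (h0 _ hmem)
    have := abs_arg_mul_le I_ne_zero (mul_ne_zero (pow_ne_zero j I_ne_zero) hL)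
    rw [arg_I, abs_of_pos Real.pi_div_two_pos, ← mul_assoc, ← I_pow_val_add_one] at this
    linarith
  have hcyclic : ∑ j, start (j + 1) = ∑ j, start j := Equiv.sum_comp (Equiv.addRight 1) start
  have hsum_edge := Finset.sum_le_sum fun j (_ : j ∈ Finset.univ) => hedge j
  have hsum_corner := Finset.sum_le_sum fun j (_ : j ∈ Finset.univ) => hcorner j
  simp only [Finset.sum_add_distrib, Finset.sum_sub_distrib] at hsum_edge hsum_corner
  rw [hcyclic, Finset.sum_const, Finset.card_univ, Fintype.card_fin, nsmul_eq_mul] at hsum_corner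
  push_cast at hsum_corner
  unfold rectVariation
  linarith

theorem rectVariation_exp_mul_le (hf : Differentiable ℂ f) (hw : 0 ≤ w) (hh : 0 ≤ h)
    (h0 : ∀ ζ ∈ rectLines z w h, f ζ ≠ 0) (c : ℂ) :
    rectVariation (fun ζ => exp (c * ζ) * f ζ) z w h ≤
      ‖c‖ * (2 * w + 2 * h) + rectVariation f z w h := by
  rw [rectVariation, rectVariation, ← sum_rectSide, Finset.mul_sum, ← Finset.sum_add_distrib]
  exact Finset.sum_le_sum fun j _ => edgeVariation_exp_mul_le hf (rectSide_nonneg hw hh j)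
    (by simp) (fun t => h0 _ (rectVertex_add_mem_rectLines z w h j t)) c

end Variation

section ArgumentPrinciple

open Complex Set

/-- The integral of `g` along the segment of length `ℓ` from `z` in the unit direction `u`. -/
noncomputable def edgeIntegral (g : ℂ → ℂ) (z u : ℂ) (ℓ : ℝ) : ℂ :=
  ∫ t in (0 : ℝ)..ℓ, u * g (z + t * u)

/-- The counterclockwise integral of `g` along the boundary of the rectangle with lower left corner
`z`, width `w` and height `h`. -/
noncomputable def rectIntegral (g : ℂ → ℂ) (z : ℂ) (w h : ℝ) : ℂ :=
  ∑ j : Fin 4, edgeIntegral g (rectVertex z w h j) (I ^ (j : ℕ)) (rectSide w h j)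

/-- The closed rectangle with lower left corner `z`, width `w` and height `h`. -/
def closedRect (z : ℂ) (w h : ℝ) : Set ℂ :=
  Icc z.re (z.re + w) ×ℂ Icc z.im (z.im + h)

/-- The open rectangle with lower left corner `z`, width `w` and height `h`. -/
def openRect (z : ℂ) (w h : ℝ) : Set ℂ :=
  Ioo z.re (z.re + w) ×ℂ Ioo z.im (z.im + h)

section Edge

variable {f : ℂ → ℂ} {z u a : ℂ} {ℓ : ℝ}

theorem edgeIntegral_im_le_edgeVariation (hf : Differentiable ℂ f) (hℓ : 0 ≤ ℓ)
    (h0 : ∀ t : ℝ, f (z + t * u) ≠ 0) :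
    (edgeIntegral (logDeriv f) z u ℓ).im ≤ edgeVariation f z u ℓ := by
  have hL : Continuous fun t : ℝ => u * logDeriv f (z + t * u) :=
    continuous_const.mul (continuous_logDeriv_edge hf h0)
  have him := imCLM.intervalIntegral_comp_comm
    (hL.intervalIntegrable (μ := MeasureTheory.volume) 0 ℓ)
  simp only [imCLM_apply] at him
  rw [edgeIntegral, edgeVariation, ← him]
  exact intervalIntegral.integral_mono_on hℓ ((continuous_im.comp hL).intervalIntegrable _ _)
    ((continuous_im.comp hL).abs.intervalIntegrable _ _) fun t _ => le_abs_self _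

theorem edgeIntegral_one (g : ℂ → ℂ) (z : ℂ) (ℓ : ℝ) :
    edgeIntegral g z 1 ℓ = ∫ x : ℝ in z.re..z.re + ℓ, g (x + z.im * I) := by
  have hshift := intervalIntegral.integral_comp_add_left (a := 0) (b := ℓ)
    (fun x : ℝ => g (x + z.im * I)) z.re
  rw [add_zero] at hshift
  rw [← hshift, edgeIntegral]
  congr with t
  rw [one_mul, mul_one, ofReal_add, add_right_comm, re_add_im]

theorem edgeIntegral_I (g : ℂ → ℂ) (z : ℂ) (ℓ : ℝ) :
    edgeIntegral g z I ℓ = I * ∫ y : ℝ in z.im..z.im + ℓ, g (z.re + y * I) := by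
  have hshift := intervalIntegral.integral_comp_add_left (a := 0) (b := ℓ)
    (fun y : ℝ => g (z.re + y * I)) z.im
  rw [add_zero] at hshift
  rw [← hshift, ← intervalIntegral.integral_const_mul, edgeIntegral]
  congr with t
  rw [ofReal_add, add_mul, ← add_assoc, re_add_im]

theorem edgeIntegral_reverse (g : ℂ → ℂ) (z u : ℂ) (ℓ : ℝ) :
    edgeIntegral g (z + ℓ * u) (-u) ℓ = -edgeIntegral g z u ℓ := by
  have hflip := intervalIntegral.integral_comp_sub_left (a := 0) (b := ℓ)
    (fun t : ℝ => u * g (z + t * u)) ℓ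
  rw [sub_self, sub_zero] at hflip
  rw [edgeIntegral, edgeIntegral, ← hflip, ← intervalIntegral.integral_neg]
  congr with t
  rw [neg_mul]
  congr 3
  push_cast
  ring

/- On the half plane below the edge the integrand has the primitive `log ((ζ - a) / u)`. -/
theorem edgeIntegral_inv_sub_im (ha : ((z - a) / u).im < 0) :
    (edgeIntegral (fun ζ => (ζ - a)⁻¹) z u ℓ).im =
      arg ((z + ℓ * u - a) / u) - arg ((z - a) / u) := by
  have hu : u ≠ 0 := by rintro rfl; simp at ha
  have hquot (t : ℝ) : (z + t * u - a) / u = (z - a) / u + t := by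
    rw [add_sub_right_comm, add_div, mul_div_cancel_right₀ _ hu]
  have him (t : ℝ) : ((z - a) / u + t : ℂ).im < 0 := by simpa using ha
  have hne (t : ℝ) : z + t * u - a ≠ 0 := fun h => by
    have := him t
    rw [← hquot, h, zero_div, zero_im] at this
    exact this.false
  have hder (t : ℝ) : HasDerivAt (fun t : ℝ => log ((z - a) / u + t))
      (u * (z + t * u - a)⁻¹) t := by
    have hline : HasDerivAt (fun t : ℝ => (z - a) / u + (t : ℂ)) 1 t :=
      (ofRealCLM.hasDerivAt (x := t)).const_add _
    refine (hline.clog_real (Or.inr (him t).ne)).congr_deriv ?_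
    rw [← hquot, one_div_div, div_eq_mul_inv]
  have hcont : Continuous fun t : ℝ => u * (z + t * u - a)⁻¹ :=
    continuous_const.mul (Continuous.inv₀ (by fun_prop) hne)
  rw [edgeIntegral, intervalIntegral.integral_eq_sub_of_hasDerivAt (fun t _ => hder t)
    (hcont.intervalIntegrable _ _), sub_im, log_im, log_im, hquot, ofReal_zero, add_zero]

theorem edgeIntegral_logDeriv_sub_mul (hf : Differentiable ℂ f)
    (ha : ∀ t : ℝ, z + t * u - a ≠ 0) (h0 : ∀ t : ℝ, f (z + t * u) ≠ 0) :
    edgeIntegral (logDeriv fun ζ => (ζ - a) * f ζ) z u ℓ =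
      edgeIntegral (fun ζ => (ζ - a)⁻¹) z u ℓ + edgeIntegral (logDeriv f) z u ℓ := by
  have hinv : Continuous fun t : ℝ => (z + t * u - a)⁻¹ := Continuous.inv₀ (by fun_prop) ha
  have hL := continuous_logDeriv_edge hf h0
  have hprod (t : ℝ) : logDeriv (fun ζ => (ζ - a) * f ζ) (z + t * u) =
      (z + t * u - a)⁻¹ + logDeriv f (z + t * u) := by
    rw [logDeriv_mul (f := fun ζ => ζ - a) _ (ha t) (h0 t) (by fun_prop) (hf _), logDeriv_apply]
    simp
  simp only [edgeIntegral, hprod, mul_add]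
  exact intervalIntegral.integral_add ((continuous_const.mul hinv).intervalIntegrable _ _)
    ((continuous_const.mul hL).intervalIntegrable _ _)

end Edge

section Rectangle

variable {f : ℂ → ℂ} {z a : ℂ} {w h : ℝ}

theorem rectIntegral_im_le_rectVariation (hf : Differentiable ℂ f) (hw : 0 ≤ w) (hh : 0 ≤ h)
    (h0 : ∀ ζ ∈ rectLines z w h, f ζ ≠ 0) :
    (rectIntegral (logDeriv f) z w h).im ≤ rectVariation f z w h := by
  rw [rectIntegral, im_sum]
  exact Finset.sum_le_sum fun j _ => edgeIntegral_im_le_edgeVariation hf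
    (rectSide_nonneg hw hh j) fun t => h0 _ (rectVertex_add_mem_rectLines z w h j t)

theorem rectIntegral_eq_zero {g : ℂ → ℂ} (hw : 0 ≤ w) (hh : 0 ≤ h)
    (hg : DifferentiableOn ℂ g (closedRect z w h)) : rectIntegral g z w h = 0 := by
  have hcauchy := integral_boundary_rect_eq_zero_of_differentiableOn g z (z + w + h * I) (by
    simpa [closedRect, uIcc_of_le (le_add_of_nonneg_right hw : z.re ≤ z.re + w),
      uIcc_of_le (le_add_of_nonneg_right hh : z.im ≤ z.im + h)] using hg)
  have hbottom := edgeIntegral_one g z w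
  have hright := edgeIntegral_I g (z + w) h
  have htop := edgeIntegral_reverse g (z + h * I) 1 w
  have hleft := edgeIntegral_reverse g z I h
  rw [edgeIntegral_one, mul_one, add_right_comm] at htop
  rw [edgeIntegral_I] at hleft
  simp only [add_re, add_im, mul_re, mul_im, ofReal_re, ofReal_im, I_re, I_im, mul_zero, mul_one,
    sub_self, add_zero, smul_eq_mul] at hcauchy hright htop
  have hI3 : I ^ 3 = -I := by rw [pow_succ, I_sq, neg_one_mul]
  simp only [rectIntegral, Fin.sum_univ_four, rectVertex, rectSide, Matrix.cons_val,
    Fin.coe_ofNat_eq_mod, Nat.reduceMod, pow_zero, pow_one, I_sq, hI3, hbottom, hright, htop,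
    hleft]
  linear_combination hcauchy

theorem arg_I_mul_of_im_neg {p : ℂ} (hp : p.im < 0) : arg (I * p) = arg p + Real.pi / 2 := by
  have hneg := arg_neg_iff.2 hp
  have hgt := neg_pi_lt_arg p
  have hp0 : p ≠ 0 := by rintro rfl; simp at hp
  rw [arg_mul I_ne_zero hp0, arg_I, add_comm]
  rw [arg_I]
  constructor <;> linarith

theorem im_rectVertex_sub_div_neg (ha : a ∈ openRect z w h) (j : Fin 4) :
    ((rectVertex z w h j - a) / I ^ (j : ℕ)).im < 0 := by
  obtain ⟨⟨hleft, hright⟩, hbottom, htop⟩ := ha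
  fin_cases j <;> simp_all [rectVertex, pow_succ, div_neg]

/- From each corner to the next, `arg ((ζ - a) / I ^ j)` changes to the branch
`arg ((ζ - a) / I ^ (j + 1))`, a jump by `π / 2`. -/
theorem rectIntegral_inv_sub_im (ha : a ∈ openRect z w h) :
    (rectIntegral (fun ζ => (ζ - a)⁻¹) z w h).im = 2 * Real.pi := by
  set θ : Fin 4 → ℝ := fun j => arg ((rectVertex z w h j - a) / I ^ (j : ℕ))
  have hedge (j : Fin 4) : (edgeIntegral (fun ζ => (ζ - a)⁻¹) (rectVertex z w h j) (I ^ (j : ℕ))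
      (rectSide w h j)).im = θ (j + 1) - θ j + Real.pi / 2 := by
    have hI : (rectVertex z w h (j + 1) - a) / I ^ (j : ℕ) =
        I * ((rectVertex z w h (j + 1) - a) / I ^ ((j + 1 : Fin 4) : ℕ)) := by
      rw [I_pow_val_add_one, mul_div_assoc', mul_div_mul_left _ _ I_ne_zero]
    rw [edgeIntegral_inv_sub_im (im_rectVertex_sub_div_neg ha j), ← rectVertex_add_one, hI,
      arg_I_mul_of_im_neg (im_rectVertex_sub_div_neg ha (j + 1))]
    ring
  have hcyclic : ∑ j, θ (j + 1) = ∑ j, θ j := Equiv.sum_comp (Equiv.addRight 1) θ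
  rw [rectIntegral, im_sum]
  simp only [hedge, Finset.sum_add_distrib, Finset.sum_sub_distrib, hcyclic, Finset.sum_const,
    Finset.card_univ, Fintype.card_fin, nsmul_eq_mul]
  push_cast
  ring

theorem mem_openRect_of_notMem_rectLines (ha : a ∈ closedRect z w h) (hl : a ∉ rectLines z w h) :
    a ∈ openRect z w h := by
  obtain ⟨⟨h1, h2⟩, h3, h4⟩ := ha
  simp only [rectLines, mem_ofPred_eq, not_or] at hl
  exact ⟨⟨h1.lt_of_ne' hl.1, h2.lt_of_ne hl.2.1⟩, h3.lt_of_ne' hl.2.2.1, h4.lt_of_ne hl.2.2.2⟩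

theorem notMem_rectLines_of_mem_openRect (ha : a ∈ openRect z w h) : a ∉ rectLines z w h := by
  obtain ⟨⟨h1, h2⟩, h3, h4⟩ := ha
  rintro (h | h | h | h)
  exacts [h1.ne' h, h2.ne h, h3.ne' h, h4.ne h]

theorem rectIntegral_logDeriv_sub_mul (hf : Differentiable ℂ f) (ha : a ∈ openRect z w h)
    (h0 : ∀ ζ ∈ rectLines z w h, f ζ ≠ 0) :
    rectIntegral (logDeriv fun ζ => (ζ - a) * f ζ) z w h =
      rectIntegral (fun ζ => (ζ - a)⁻¹) z w h + rectIntegral (logDeriv f) z w h := by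
  have hsub : ∀ ζ ∈ rectLines z w h, ζ - a ≠ 0 := fun ζ hζ =>
    sub_ne_zero.2 (ne_of_mem_of_not_mem hζ (notMem_rectLines_of_mem_openRect ha))
  have hmem := rectVertex_add_mem_rectLines z w h
  simp only [rectIntegral, ← Finset.sum_add_distrib]
  exact Finset.sum_congr rfl fun j _ => edgeIntegral_logDeriv_sub_mul hf
    (fun t => hsub _ (hmem j t)) fun t => h0 _ (hmem j t)

theorem exists_differentiable_eq_sub_mul (hf : Differentiable ℂ f) (ha : f a = 0) :
    ∃ g : ℂ → ℂ, Differentiable ℂ g ∧ f = fun ζ => (ζ - a) * g ζ := by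
  refine ⟨dslope f a, ?_, ?_⟩
  · rw [← differentiableOn_univ, differentiableOn_dslope Filter.univ_mem]
    exact hf.differentiableOn
  · funext ζ
    rw [← smul_eq_mul, sub_smul_dslope, ha, sub_zero]

theorem analyticOrderAt_sub_mul {g : ℂ → ℂ} (hg : Differentiable ℂ g) (a ζ : ℂ) :
    analyticOrderAt (fun ζ => (ζ - a) * g ζ) ζ =
      (if ζ = a then 1 else 0) + analyticOrderAt g ζ := by
  have hlin : analyticOrderAt (fun ζ : ℂ => ζ - a) ζ = if ζ = a then 1 else 0 := by
    split_ifs with hζ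
    · rw [hζ]
      exact analyticOrderAt_id_sub_const_self
    · exact analyticOrderAt_id_sub_const_of_ne hζ
  rw [← hlin]
  exact analyticOrderAt_mul (by fun_prop) (hg.analyticAt ζ)

theorem rectIntegral_logDeriv_im (hw : 0 ≤ w) (hh : 0 ≤ h) {T : Finset ℂ}
    (hT : ∀ a ∈ T, a ∈ openRect z w h) (n : ℕ) (hf : Differentiable ℂ f)
    (h0 : ∀ ζ ∈ rectLines z w h, f ζ ≠ 0) (hz : ∀ ζ ∈ closedRect z w h, f ζ = 0 → ζ ∈ T)
    (hn : ∑ a ∈ T, analyticOrderAt f a = n) :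
    (rectIntegral (logDeriv f) z w h).im = 2 * Real.pi * n := by
  induction n generalizing f with
  | zero =>
    have hne : ∀ ζ ∈ closedRect z w h, f ζ ≠ 0 := fun ζ hζ hfζ =>
      (hf.analyticAt ζ).analyticOrderAt_eq_zero.1 (Finset.sum_eq_zero_iff.1 hn ζ (hz ζ hζ hfζ)) hfζ
    rw [logDeriv,
      rectIntegral_eq_zero hw hh (hf.deriv.differentiableOn.div hf.differentiableOn hne)]
    simp
  | succ n ih =>
    obtain ⟨a, haT, ha⟩ := Finset.exists_ne_zero_of_sum_ne_zero
      (hn.trans_ne (Nat.cast_ne_zero.2 n.succ_ne_zero))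
    obtain ⟨g, hg, rfl⟩ :=
      exists_differentiable_eq_sub_mul hf (apply_eq_zero_of_analyticOrderAt_ne_zero ha)
    have hg0 : ∀ ζ ∈ rectLines z w h, g ζ ≠ 0 := fun ζ hζ => right_ne_zero_of_mul (h0 ζ hζ)
    have hsum : ∑ a ∈ T, analyticOrderAt g a = n := by
      simp only [analyticOrderAt_sub_mul hg, Finset.sum_add_distrib, Finset.sum_ite_eq',
        if_pos haT] at hn
      rw [Nat.cast_succ, add_comm] at hn
      exact WithTop.add_right_cancel ENat.one_ne_top hn
    rw [rectIntegral_logDeriv_sub_mul hg (hT a haT) hg0, add_im,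
      rectIntegral_inv_sub_im (hT a haT), ih hg hg0 (fun ζ hζ h => hz ζ hζ (by simp [h])) hsum]
    push_cast
    ring

theorem finite_zeros_inter_closedRect (hf : Differentiable ℂ f) (hne : f ≠ 0) :
    (closedRect z w h ∩ f ⁻¹' {0}).Finite := by
  obtain ⟨ζ, hζ⟩ := Function.ne_iff.1 hne
  have hK : IsCompact (closedRect z w h) := isCompact_Icc.reProdIm isCompact_Icc
  have hco : f ⁻¹' {0}ᶜ ∈ Filter.codiscrete ℂ :=
    AnalyticOnNhd.preimage_zero_mem_codiscrete (fun x _ => hf.analyticAt x) hζ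
  simpa [sdiff_eq] using hK.finite_sdiff_of_mem_codiscreteWithin
    (Filter.codiscreteWithin_mono (subset_univ _) hco)

theorem zeroCount_closedRect_le (hw : 0 ≤ w) (hh : 0 ≤ h) (hf : Differentiable ℂ f)
    (h0 : ∀ ζ ∈ rectLines z w h, f ζ ≠ 0) :
    zeroCount f (closedRect z w h) ≤ (⌊rectVariation f z w h / (2 * Real.pi)⌋₊ : ℕ) := by
  have hne : f ≠ 0 := fun hf0 => h0 z (Or.inl rfl) (by simp [hf0])
  have hfin := finite_zeros_inter_closedRect (z := z) (w := w) (h := h) hf hne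
  have htop : ∑ a ∈ hfin.toFinset, analyticOrderAt f a ≠ ⊤ := WithTop.sum_ne_top.2 fun a _ =>
    mt (AnalyticOnNhd.analyticOrderAt_eq_top_iff_eq_zero a fun x => hf.analyticAt x).1 hne
  obtain ⟨n, hn⟩ := ENat.ne_top_iff_exists.1 htop
  have him := rectIntegral_logDeriv_im hw hh
    (fun a ha => mem_openRect_of_notMem_rectLines (hfin.mem_toFinset.1 ha).1
      fun hl => h0 a hl (hfin.mem_toFinset.1 ha).2) n hf h0
    (fun ζ hζ h => hfin.mem_toFinset.2 ⟨hζ, h⟩) hn.symm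
  have hle := him ▸ rectIntegral_im_le_rectVariation hf hw hh h0
  refine iSup₂_le fun S hS => ?_
  calc ∑ a ∈ S, analyticOrderAt f a ≤ ∑ a ∈ hfin.toFinset, analyticOrderAt f a :=
        Finset.sum_le_sum_of_ne_zero fun a ha h => hfin.mem_toFinset.2
          ⟨hS ha, apply_eq_zero_of_analyticOrderAt_ne_zero h⟩
    _ = n := hn.symm
    _ ≤ (⌊rectVariation f z w h / (2 * Real.pi)⌋₊ : ℕ) := by
        gcongr
        exact Nat.le_floor ((le_div_iff₀' Real.two_pi_pos).2 hle)

end Rectangle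

end ArgumentPrinciple

section Operators

open Complex Set

/-- The space of entire functions. -/
def entireFunctions : Submodule ℂ (ℂ → ℂ) where
  carrier := {f | Differentiable ℂ f}
  add_mem' hf hg := Differentiable.add hf hg
  zero_mem' := differentiable_const 0
  smul_mem' c _ hf := Differentiable.const_smul hf c

/-- Differentiation as an endomorphism of the space of entire functions, so that the differential
operator with characteristic polynomial `p` is `aeval entireDeriv p`. -/
noncomputable def entireDeriv : Module.End ℂ entireFunctions where
  toFun f := ⟨deriv f.1, Differentiable.deriv f.2⟩
  map_add' f g := Subtype.ext (funext fun z => deriv_add (f.2 z) (g.2 z))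
  map_smul' c f := Subtype.ext (funext fun z => deriv_const_smul c (f.2 z))

/-- Multiplication by `exp (c z)` as an endomorphism of the space of entire functions. It
intertwines `entireDeriv` with its translates `aeval entireDeriv (X - C μ)`. -/
noncomputable def entireExpMul (c : ℂ) : Module.End ℂ entireFunctions where
  toFun f := ⟨fun z => exp (c * z) * f.1 z, (differentiable_id.const_mul c).cexp.mul f.2⟩
  map_add' f g := Subtype.ext (funext fun z => mul_add _ (f.1 z) (g.1 z))
  map_smul' a f := Subtype.ext (funext fun z => mul_left_comm _ a (f.1 z))

theorem aeval_entireDeriv_X_sub_C (μ : ℂ) (f : entireFunctions) :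
    aeval entireDeriv (X - C μ) f = entireDeriv f - μ • f := by
  rw [map_sub, aeval_X, aeval_C, LinearMap.sub_apply, Module.algebraMap_end_apply]

theorem entireDeriv_pow_apply (n : ℕ) (f : entireFunctions) :
    ((entireDeriv ^ n) f : ℂ → ℂ) = iteratedDeriv n f := by
  induction n with
  | zero => simp
  | succ n ih =>
    rw [pow_succ', Module.End.mul_apply, iteratedDeriv_succ, ← ih]
    rfl

theorem entireExpMul_add_apply (c d : ℂ) (f : entireFunctions) :
    entireExpMul (c + d) f = entireExpMul c (entireExpMul d f) := by
  ext z
  change exp ((c + d) * z) * f.1 z = exp (c * z) * (exp (d * z) * f.1 z)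
  rw [add_mul, Complex.exp_add, mul_assoc]

theorem entireExpMul_apply_ne_zero (c : ℂ) {f : entireFunctions} {z : ℂ} (h : f.1 z ≠ 0) :
    (entireExpMul c f).1 z ≠ 0 :=
  mul_ne_zero (exp_ne_zero _) h

theorem entireExpMul_neg_semiconjBy (μ : ℂ) :
    SemiconjBy (entireExpMul (-μ)) (aeval entireDeriv (X - C μ)) entireDeriv := by
  refine LinearMap.ext fun f => Subtype.ext (funext fun z => ?_)
  rw [Module.End.mul_apply, Module.End.mul_apply, aeval_entireDeriv_X_sub_C]
  have hexp : HasDerivAt (fun z => exp (-μ * z)) (exp (-μ * z) * -μ) z := by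
    simpa using ((hasDerivAt_id z).const_mul (-μ)).cexp
  have hmul := (hexp.mul (f.2 z).hasDerivAt).deriv
  change exp (-μ * z) * (deriv f.1 z - μ * f.1 z) = deriv (fun z => exp (-μ * z) * f.1 z) z
  exact (by ring : _ = exp (-μ * z) * -μ * f.1 z + exp (-μ * z) * deriv f.1 z).trans hmul.symm

theorem entireDeriv_entireExpMul_neg (μ : ℂ) (f : entireFunctions) :
    entireDeriv (entireExpMul (-μ) f) = entireExpMul (-μ) (aeval entireDeriv (X - C μ) f) :=
  (LinearMap.congr_fun (entireExpMul_neg_semiconjBy μ) f).symm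

theorem countable_zeros {f : ℂ → ℂ} (hf : Differentiable ℂ f) (hne : f ≠ 0) :
    (f ⁻¹' {0}).Countable := by
  have hcover : f ⁻¹' {0} ⊆
      ⋃ n : ℕ, closedRect (-n - n * I) (2 * n) (2 * n) ∩ f ⁻¹' {0} := fun ζ hζ => by
    obtain ⟨n, hn⟩ := exists_nat_ge ‖ζ‖
    have hre := abs_le.1 ((abs_re_le_norm ζ).trans hn)
    have him := abs_le.1 ((abs_im_le_norm ζ).trans hn)
    refine mem_iUnion.2 ⟨n, ⟨⟨?_, ?_⟩, ?_, ?_⟩, hζ⟩ <;> simp <;> linarith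
  exact (countable_iUnion fun _ => (finite_zeros_inter_closedRect hf hne).countable).mono hcover

theorem polygonalLength_nonneg (p : List ℂ) : 0 ≤ polygonalLength p := by
  fun_induction polygonalLength p with
  | case1 | case2 => exact le_rfl
  | case3 z w l ih => exact add_nonneg dist_nonneg ih

theorem rectVariation_entireExpMul_neg_of_eigenvector {μ : ℂ} {f : entireFunctions}
    (hf : aeval entireDeriv (X - C μ) f = 0) (z : ℂ) (w h : ℝ) :
    rectVariation (entireExpMul (-μ) f).1 z w h = 0 := by
  have hderiv : deriv (entireExpMul (-μ) f).1 = 0 := by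
    have := entireDeriv_entireExpMul_neg μ f
    rw [hf, map_zero] at this
    exact congrArg Subtype.val this
  simp [rectVariation, edgeVariation, logDeriv, hderiv]

theorem rectVariation_entireExpMul_neg_le {z : ℂ} {w h : ℝ} (hw : 0 ≤ w) (hh : 0 ≤ h)
    {f : entireFunctions} {μ : ℂ} (hf0 : ∀ ζ ∈ rectLines z w h, f.1 ζ ≠ 0)
    (hg0 : ∀ ζ ∈ rectLines z w h, (aeval entireDeriv (X - C μ) f).1 ζ ≠ 0) (ν : ℂ) :
    rectVariation (entireExpMul (-μ) f).1 z w h ≤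
      dist μ ν * (2 * w + 2 * h) +
        rectVariation (entireExpMul (-ν) (aeval entireDeriv (X - C μ) f)).1 z w h +
        2 * Real.pi := by
  set g := aeval entireDeriv (X - C μ) f
  have hderiv : deriv (entireExpMul (-μ) f).1 = (entireExpMul (-μ) g).1 :=
    congrArg Subtype.val (entireDeriv_entireExpMul_neg μ f)
  have hsplit : entireExpMul (-μ) g = entireExpMul (ν - μ) (entireExpMul (-ν) g) := by
    rw [← entireExpMul_add_apply]
    ring_nf
  have hrolle := rectVariation_le_deriv (entireExpMul (-μ) f).2 hw hh
    (fun ζ hζ => entireExpMul_apply_ne_zero _ (hf0 ζ hζ))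
    (fun ζ hζ => hderiv ▸ entireExpMul_apply_ne_zero _ (hg0 ζ hζ))
  have htwist := rectVariation_exp_mul_le (entireExpMul (-ν) g).2 hw hh
    (fun ζ hζ => entireExpMul_apply_ne_zero _ (hg0 ζ hζ)) (ν - μ)
  rw [← dist_eq_norm, dist_comm] at htwist
  rw [hderiv, hsplit] at hrolle
  exact hrolle.trans (add_le_add_left htwist _)

theorem exists_countable_rectVariation_le (l : List ℂ) (μ : ℂ) {f : entireFunctions}
    (hne : f ≠ 0) (hf : aeval entireDeriv ((μ :: l).map fun ν => X - C ν).prod f = 0) :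
    ∃ E : Set ℂ, E.Countable ∧ ∀ z w h, 0 ≤ w → 0 ≤ h → (∀ ζ ∈ rectLines z w h, ζ ∉ E) →
      (∀ ζ ∈ rectLines z w h, f.1 ζ ≠ 0) ∧
      rectVariation (entireExpMul (-μ) f).1 z w h ≤
        2 * Real.pi * l.length + (2 * w + 2 * h) * polygonalLength (μ :: l) := by
  have hzeros := countable_zeros f.2 fun h => hne (Subtype.ext h)
  by_cases heigen : aeval entireDeriv (X - C μ) f = 0
  · refine ⟨f.1 ⁻¹' {0}, hzeros, fun z w h hw hh hE => ⟨hE, ?_⟩⟩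
    rw [rectVariation_entireExpMul_neg_of_eigenvector heigen]
    have := polygonalLength_nonneg (μ :: l)
    positivity
  match l with
  | [] => exact absurd (by simpa using hf) heigen
  | ν :: l =>
    rw [List.map_cons, List.prod_cons, mul_comm, map_mul, Module.End.mul_apply] at hf
    obtain ⟨E, hE, hbound⟩ := exists_countable_rectVariation_le l ν heigen hf
    refine ⟨f.1 ⁻¹' {0} ∪ E, hzeros.union hE, fun z w h hw hh havoid => ?_⟩
    have hf0 : ∀ ζ ∈ rectLines z w h, f.1 ζ ≠ 0 := fun ζ hζ h0 => havoid ζ hζ (Or.inl h0)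
    obtain ⟨hg0, hg⟩ := hbound z w h hw hh fun ζ hζ h0 => havoid ζ hζ (Or.inr h0)
    have hstep := rectVariation_entireExpMul_neg_le hw hh hf0 hg0 ν
    simp only [List.length_cons, Nat.cast_add_one, polygonalLength]
    exact ⟨hf0, by linarith⟩
termination_by l.length

end Operators

section ExponentialPolynomials

open Complex

theorem ker_aeval_prod_eq_iSup {R M ι : Type*} [CommRing R] [AddCommGroup M] [Module R M]
    (f : Module.End R M) {p : ι → R[X]} {s : Finset ι}
    (hp : (s : Set ι).Pairwise (Function.onFun IsCoprime p)) :
    (aeval f (∏ i ∈ s, p i)).ker = ⨆ i ∈ s, (aeval f (p i)).ker := by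
  classical
  induction s using Finset.induction_on with
  | empty => simp [Module.End.one_eq_id]
  | insert a s ha ih =>
    have : Std.Symm (Function.onFun IsCoprime p) := ⟨fun _ _ h => h.symm⟩
    rw [Finset.coe_insert, Set.pairwise_insert_of_symm] at hp
    rw [Finset.prod_insert ha, Finset.iSup_insert, ← ih hp.1,
      sup_ker_aeval_eq_ker_aeval_mul_of_coprime f (IsCoprime.prod_right fun i hi =>
        hp.2 i hi (ne_of_mem_of_not_mem hi ha).symm)]

theorem eq_polynomial_of_iteratedDeriv_eq_zero {n : ℕ} {f : ℂ → ℂ} (hf : Differentiable ℂ f)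
    (hn : iteratedDeriv n f = 0) : ∃ P : ℂ[X], P.degree < n ∧ ∀ z, f z = P.eval z := by
  have hvanish (i : ℕ) (hi : i ∉ Finset.range n) : iteratedDeriv i f 0 = 0 := by
    obtain ⟨m, rfl⟩ := Nat.exists_eq_add_of_le (not_lt.1 (mt Finset.mem_range.2 hi))
    rw [add_comm, iteratedDeriv_eq_iterate, Function.iterate_add_apply, ← iteratedDeriv_eq_iterate,
      ← iteratedDeriv_eq_iterate, hn]
    simp
  refine ⟨∑ i ∈ Finset.range n, C ((i.factorial : ℂ)⁻¹ * iteratedDeriv i f 0) * X ^ i, ?_,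
    fun z => ?_⟩
  · refine (degree_sum_le _ _).trans_lt
      ((Finset.sup_lt_iff (WithBot.bot_lt_coe n)).2 fun i hi => ?_)
    exact (degree_C_mul_X_pow_le _ _).trans_lt (Nat.cast_lt.2 (Finset.mem_range.1 hi))
  · rw [← taylorSeries_eq_of_entire' 0 z hf,
      tsum_eq_sum (s := Finset.range n) fun i hi => by simp [hvanish i hi]]
    simp [eval_finsetSum]

theorem exists_eq_eval_mul_exp {μ : ℂ} {n : ℕ} {f : entireFunctions}
    (hf : aeval entireDeriv ((X - C μ) ^ n) f = 0) :
    ∃ P : ℂ[X], P.degree < n ∧ ∀ z, f.1 z = P.eval z * exp (μ * z) := by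
  have hderiv : (entireDeriv ^ n) (entireExpMul (-μ) f) = 0 := by
    rw [map_pow] at hf
    have := LinearMap.congr_fun ((entireExpMul_neg_semiconjBy μ).pow_right n) f
    rw [Module.End.mul_apply, Module.End.mul_apply, hf, map_zero] at this
    exact this.symm
  obtain ⟨P, hdeg, hP⟩ := eq_polynomial_of_iteratedDeriv_eq_zero (entireExpMul (-μ) f).2
    ((entireDeriv_pow_apply n _).symm.trans (congrArg Subtype.val hderiv))
  refine ⟨P, hdeg, fun z => ?_⟩
  have hcancel : exp (-μ * z) * exp (μ * z) = 1 := by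
    rw [← Complex.exp_add, neg_mul, neg_add_cancel, Complex.exp_zero]
  rw [← hP z]
  exact (by linear_combination (-f.1 z) * hcancel :
    f.1 z = exp (-μ * z) * f.1 z * exp (μ * z))

theorem exists_eq_sum_eval_mul_exp {s : Multiset ℂ} {f : entireFunctions}
    (hf : aeval entireDeriv (s.map fun μ => X - C μ).prod f = 0) :
    ∃ P : ℂ → ℂ[X], (∀ μ, (P μ).degree < s.count μ) ∧
      ∀ z, f.1 z = ∑ μ ∈ s.toFinset, (P μ).eval z * exp (μ * z) := by
  have hcoprime : (s.toFinset : Set ℂ).Pairwise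
      (Function.onFun IsCoprime fun μ => (X - C μ) ^ s.count μ) := fun _ _ _ _ hne =>
    (pairwise_coprime_X_sub_C Function.injective_id hne).pow
  rw [Finset.prod_multiset_map_count, ← LinearMap.mem_ker, ker_aeval_prod_eq_iSup _ hcoprime,
    Submodule.mem_iSup_finset_iff_exists_sum] at hf
  obtain ⟨g, rfl⟩ := hf
  choose P hdeg hP using fun μ => exists_eq_eval_mul_exp (LinearMap.mem_ker.1 (g μ).2)
  refine ⟨P, hdeg, fun z => ?_⟩
  simp only [AddSubmonoidClass.coe_finsetSum, Finset.sum_apply, hP]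

theorem odeCharPoly_coeff {k : ℕ} (a : Fin (k + 1) → ℂ) (j : Fin (k + 1)) :
    (odeCharPoly a).coeff j = a j := by
  simp [odeCharPoly, coeff_X_pow, Fin.val_inj]

variable {k : ℕ} {a : Fin (k + 1) → ℂ}

theorem natDegree_odeCharPoly (ha : a (Fin.last k) ≠ 0) : (odeCharPoly a).natDegree = k := by
  refine le_antisymm (natDegree_sum_le_of_forall_le _ _ fun j _ =>
    (natDegree_C_mul_X_pow_le _ _).trans (Nat.lt_succ_iff.1 j.2)) (le_natDegree_of_ne_zero ?_)
  exact (odeCharPoly_coeff a (Fin.last k)).trans_ne ha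

theorem leadingCoeff_odeCharPoly (ha : a (Fin.last k) ≠ 0) :
    (odeCharPoly a).leadingCoeff = a (Fin.last k) := by
  rw [← odeCharPoly_coeff a, Fin.val_last, leadingCoeff, natDegree_odeCharPoly ha]

theorem card_roots_odeCharPoly (ha : a (Fin.last k) ≠ 0) : (odeCharPoly a).roots.card = k := by
  rw [← (IsAlgClosed.splits (odeCharPoly a)).natDegree_eq_card_roots, natDegree_odeCharPoly ha]

theorem aeval_entireDeriv_odeCharPoly_eq_zero {y : ℂ → ℂ} (hy : IsODESolution a y) :
    aeval entireDeriv (odeCharPoly a) (⟨y, hy.1⟩ : entireFunctions) = 0 := by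
  refine Subtype.ext (funext fun z => Eq.trans ?_ (hy.2 z))
  simp [odeCharPoly, Module.algebraMap_end_apply, entireDeriv_pow_apply]

theorem aeval_entireDeriv_roots_eq_zero (ha : a (Fin.last k) ≠ 0) {y : ℂ → ℂ}
    (hy : IsODESolution a y) :
    aeval entireDeriv ((odeCharPoly a).roots.map fun μ => X - C μ).prod
      (⟨y, hy.1⟩ : entireFunctions) = 0 := by
  have hzero := aeval_entireDeriv_odeCharPoly_eq_zero hy
  rw [(IsAlgClosed.splits (odeCharPoly a)).eq_prod_roots, map_mul, aeval_C, Module.End.mul_apply,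
    Module.algebraMap_end_apply, smul_eq_zero, leadingCoeff_odeCharPoly ha] at hzero
  exact hzero.resolve_left ha

end ExponentialPolynomials

section Strip

open Complex Set

theorem analyticOrderAt_entireExpMul (c : ℂ) (f : entireFunctions) (z : ℂ) :
    analyticOrderAt (entireExpMul c f).1 z = analyticOrderAt f.1 z := by
  have hexp : AnalyticAt ℂ (fun ζ : ℂ => exp (c * ζ)) z := by fun_prop
  have hmul := analyticOrderAt_mul hexp (Differentiable.analyticAt f.2 z)
  rwa [hexp.analyticOrderAt_eq_zero.2 (exp_ne_zero _), zero_add] at hmul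

theorem zeroCount_entireExpMul (c : ℂ) (f : entireFunctions) (U : Set ℂ) :
    zeroCount (entireExpMul c f).1 U = zeroCount f.1 U := by
  simp only [zeroCount, analyticOrderAt_entireExpMul]

theorem zeroCount_mono (f : ℂ → ℂ) {U V : Set ℂ} (h : U ⊆ V) : zeroCount f U ≤ zeroCount f V :=
  biSup_mono fun _ hS => hS.trans h

theorem zeroCount_le_sum_of_cover {ι : Type*} {f : ℂ → ℂ} {U : Set ℂ} {s : Finset ι}
    {R : ι → Set ℂ} (hcover : ∀ ζ ∈ U, f ζ = 0 → ∃ i ∈ s, ζ ∈ R i) :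
    zeroCount f U ≤ ∑ i ∈ s, zeroCount f (R i) := by
  classical
  refine iSup₂_le fun S hS => ?_
  calc ∑ ζ ∈ S, analyticOrderAt f ζ
      ≤ ∑ ζ ∈ S, ∑ i ∈ s, if ζ ∈ R i then analyticOrderAt f ζ else 0 := by
        refine Finset.sum_le_sum fun ζ hζ => ?_
        by_cases hzero : f ζ = 0
        · obtain ⟨i, hi, hmem⟩ := hcover ζ (hS hζ) hzero
          exact (if_pos hmem).symm.le.trans (Finset.single_le_sum_of_canonicallyOrdered
            (f := fun i => if ζ ∈ R i then analyticOrderAt f ζ else 0) hi)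
        · rw [not_imp_comm.1 apply_eq_zero_of_analyticOrderAt_ne_zero hzero]
          exact zero_le
    _ = ∑ i ∈ s, ∑ ζ ∈ S with ζ ∈ R i, analyticOrderAt f ζ := by
        rw [Finset.sum_comm]
        simp only [Finset.sum_filter]
    _ ≤ ∑ i ∈ s, zeroCount f (R i) := Finset.sum_le_sum fun i _ =>
        le_iSup₂_of_le (S.filter (· ∈ R i)) (by simp [Set.subset_def]) le_rfl

theorem exists_rectLines_avoiding {E : Set ℂ} (hE : E.Countable) (b α D : ℝ) {ε : ℝ}
    (hε : 0 < ε) : ∃ s ∈ Ioo 0 ε, ∀ ζ ∈ rectLines ⟨b - (D + s), -(α + s)⟩ (2 * (D + s))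
      (2 * (α + s)), ζ ∉ E := by
  have hbad := (((hE.image fun ζ => b - D - ζ.re).union (hE.image fun ζ => ζ.re - b - D)).union
    ((hE.image fun ζ => -ζ.im - α).union (hE.image fun ζ => ζ.im - α)))
  obtain ⟨s, hs, hmem⟩ := (hbad.dense_compl ℝ).exists_between hε
  refine ⟨s, hmem, fun ζ hζ hζE => hs ?_⟩
  rcases hζ with h | h | h | h
  · exact Or.inl (Or.inl ⟨ζ, hζE, by simp only [h]; ring⟩)
  · exact Or.inl (Or.inr ⟨ζ, hζE, by simp only [h]; ring⟩)
  · exact Or.inr (Or.inl ⟨ζ, hζE, by simp only [h]; ring⟩)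
  · exact Or.inr (Or.inr ⟨ζ, hζE, by simp only [h]; ring⟩)

theorem horizontalStrip_inter_subset_closedRect (b α D : ℝ) {s : ℝ} (hs : 0 ≤ s) :
    horizontalStrip α ∩ {ζ | |ζ.re - b| ≤ D} ⊆
      closedRect ⟨b - (D + s), -(α + s)⟩ (2 * (D + s)) (2 * (α + s)) := fun ζ ⟨him, hre⟩ => by
  have him := abs_le.1 (show |ζ.im| ≤ α from him)
  have hre := abs_le.1 (show |ζ.re - b| ≤ D from hre)
  refine ⟨⟨?_, ?_⟩, ?_, ?_⟩ <;> dsimp only <;> linarith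

variable {p : List ℂ} {f : entireFunctions} {α D : ℝ}

theorem zeroCount_rect_le (hne : f ≠ 0)
    (hf : aeval entireDeriv (p.map fun μ => X - C μ).prod f = 0) (hα : 0 ≤ α) (hD : 0 ≤ D)
    (b : ℝ) :
    zeroCount f.1 (horizontalStrip α ∩ {ζ | |ζ.re - b| ≤ D}) ≤
      (⌊(p.length : ℝ) - 1 + 2 / Real.pi * (α + D) * polygonalLength p⌋₊ : ℕ) := by
  match p with
  | [] => exact absurd (by simpa using hf) hne
  | μ :: l =>
    obtain ⟨E, hE, hbound⟩ := exists_countable_rectVariation_le l μ hne hf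
    set L := polygonalLength (μ :: l)
    set B := ((μ :: l).length : ℝ) - 1 + 2 / Real.pi * (α + D) * L with hB
    -- The rectangle must be enlarged to avoid `E`; the floor absorbs a small enough enlargement.
    obtain ⟨ε, hε, hfloor⟩ :=
      exists_pos_mul_lt (sub_pos.2 (Nat.lt_floor_add_one B)) (4 / Real.pi * L)
    obtain ⟨s, ⟨hs, hsε⟩, havoid⟩ := exists_rectLines_avoiding hE b α D hε
    set z : ℂ := ⟨b - (D + s), -(α + s)⟩
    have hw : 0 ≤ 2 * (D + s) := by positivity
    have hh : 0 ≤ 2 * (α + s) := by positivity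
    obtain ⟨hf0, hV⟩ := hbound z _ _ hw hh havoid
    have hVε : rectVariation (entireExpMul (-μ) f).1 z (2 * (D + s)) (2 * (α + s)) /
        (2 * Real.pi) ≤ B + 4 / Real.pi * L * ε := by
      have hL : 0 ≤ L := polygonalLength_nonneg _
      calc _ ≤ (2 * Real.pi * l.length + (2 * (2 * (D + s)) + 2 * (2 * (α + s))) * L) /
            (2 * Real.pi) := by gcongr
        _ = B + 4 / Real.pi * L * s := by
            rw [hB, List.length_cons]
            push_cast
            field_simp
            ring
        _ ≤ B + 4 / Real.pi * L * ε := by gcongr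
    calc zeroCount f.1 (horizontalStrip α ∩ {ζ | |ζ.re - b| ≤ D})
        ≤ zeroCount (entireExpMul (-μ) f).1 (closedRect z (2 * (D + s)) (2 * (α + s))) :=
          (zeroCount_mono f.1 (horizontalStrip_inter_subset_closedRect b α D hs.le)).trans
            (zeroCount_entireExpMul (-μ) f _).ge
      _ ≤ _ := zeroCount_closedRect_le hw hh (entireExpMul (-μ) f).2 fun ζ hζ =>
          entireExpMul_apply_ne_zero _ (hf0 ζ hζ)
      _ ≤ (⌊B⌋₊ : ℕ) := Nat.cast_le.2 (Nat.lt_succ_iff.1 ((Nat.floor_lt' (by simp)).2 (by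
          push_cast
          linarith)))

/-- The set `Z` is covered by `N` vertical strips of half-width `D`. -/
def ReCoverable (Z : Set ℂ) (N : ℕ) (D : ℝ) : Prop :=
  ∃ s : Finset ℝ, s.card ≤ N ∧ ∀ ζ ∈ Z, ∃ b ∈ s, |ζ.re - b| ≤ D

theorem zeroCount_horizontalStrip_le (hne : f ≠ 0)
    (hf : aeval entireDeriv (p.map fun μ => X - C μ).prod f = 0) (hα : 0 ≤ α) (hD : 0 ≤ D)
    {N : ℕ} (hcover : ReCoverable (horizontalStrip α ∩ f.1 ⁻¹' {0}) N D) :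
    zeroCount f.1 (horizontalStrip α) ≤
      (N * ⌊(p.length : ℝ) - 1 + 2 / Real.pi * (α + D) * polygonalLength p⌋₊ : ℕ) := by
  obtain ⟨s, hcard, hs⟩ := hcover
  calc zeroCount f.1 (horizontalStrip α)
      ≤ ∑ b ∈ s, zeroCount f.1 (horizontalStrip α ∩ {ζ | |ζ.re - b| ≤ D}) :=
        zeroCount_le_sum_of_cover fun ζ hζ h0 => (hs ζ ⟨hζ, h0⟩).imp fun b hb => ⟨hb.1, hζ, hb.2⟩
    _ ≤ ∑ b ∈ s, _ := Finset.sum_le_sum fun b _ => zeroCount_rect_le hne hf hα hD b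
    _ ≤ _ := by
        rw [Finset.sum_const, nsmul_eq_mul]
        exact_mod_cast Nat.mul_le_mul_right _ hcard

end Strip

section ShortestPath

theorem polygonalLength_cons_le (a b : ℂ) (l : List ℂ) :
    polygonalLength (a :: l) ≤ dist a b + polygonalLength (b :: l) := by
  cases l with
  | nil => exact add_nonneg dist_nonneg le_rfl
  | cons c l =>
    simp only [polygonalLength]
    linarith [dist_triangle a b c]

theorem polygonalLength_le_cons (a : ℂ) (l : List ℂ) :
    polygonalLength l ≤ polygonalLength (a :: l) := by
  cases l with
  | nil => exact le_rfl
  | cons c l => exact le_add_of_nonneg_left dist_nonneg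

theorem polygonalLength_cons_le_of_sublist {l p : List ℂ} (h : l.Sublist p) (a : ℂ) :
    polygonalLength (a :: l) ≤ polygonalLength (a :: p) := by
  induction h generalizing a with
  | slnil => rfl
  | cons b _ ih => exact (polygonalLength_cons_le a b _).trans (add_le_add_right (ih b) _)
  | cons_cons b _ ih => exact add_le_add_right (ih b) _

theorem polygonalLength_le_of_sublist {l p : List ℂ} (h : l.Sublist p) :
    polygonalLength l ≤ polygonalLength p := by
  cases h with
  | slnil => rfl
  | cons b h => exact (polygonalLength_le_cons b _).trans (polygonalLength_cons_le_of_sublist h b)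
  | cons_cons b h => exact polygonalLength_cons_le_of_sublist h b

theorem segment_subset_union_of_mem {E : Type*} [AddCommGroup E] [Module ℝ E] {z w v : E}
    (hv : v ∈ segment ℝ z w) : segment ℝ z w ⊆ segment ℝ z v ∪ segment ℝ v w := fun u hu => by
  have hvw := mem_segment_iff_wbtw.1 hv
  have huw := mem_segment_iff_wbtw.1 hu
  have hcases : Wbtw ℝ z u v ∨ Wbtw ℝ z v u := by
    obtain ⟨s, hs, rfl⟩ := huw
    obtain ⟨t, ht, rfl⟩ := hvw
    exact wbtw_or_wbtw_smul_vadd_of_nonneg z (w - z) hs.1 ht.1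
  exact hcases.imp mem_segment_iff_wbtw.2 fun h => mem_segment_iff_wbtw.2 (huw.trans_left_right h)

theorem exists_insert_mem_polygonalTrace {v : ℂ} (l : List ℂ) (a : ℂ)
    (hv : v ∈ polygonalTrace (a :: l)) :
    ∃ q, v ∈ a :: q ∧ l.Sublist q ∧ polygonalTrace (a :: l) ⊆ polygonalTrace (a :: q) ∧
      polygonalLength (a :: q) = polygonalLength (a :: l) := by
  induction l generalizing a with
  | nil => exact ⟨[], by simpa [polygonalTrace] using hv, List.Sublist.refl _, subset_rfl, rfl⟩
  | cons b l ih =>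
    rcases hv with hv | hv
    · refine ⟨v :: b :: l, by simp, List.sublist_cons_self _ _, ?_, ?_⟩
      · simp only [polygonalTrace, ← Set.union_assoc]
        exact Set.union_subset_union_left _ (segment_subset_union_of_mem hv)
      · simp only [polygonalLength, ← add_assoc, dist_add_dist_of_mem_segment hv]
    · obtain ⟨q, hvq, hsub, htrace, hlength⟩ := ih b hv
      exact ⟨b :: q, List.mem_cons_of_mem _ hvq, hsub.cons_cons b,
        Set.union_subset_union_right _ htrace, congrArg (dist a b + ·) hlength⟩

theorem exists_path_through_vertices (Λ : Finset ℂ) (p : List ℂ)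
    (h : (Λ : Set ℂ) ⊆ polygonalTrace p) :
    ∃ q : List ℂ, (∀ v ∈ Λ, v ∈ q) ∧ polygonalTrace p ⊆ polygonalTrace q ∧
      polygonalLength q = polygonalLength p := by
  induction Λ using Finset.induction_on with
  | empty => exact ⟨p, by simp, subset_rfl, rfl⟩
  | insert v Λ _ ih =>
    rw [Finset.coe_insert, Set.insert_subset_iff] at h
    obtain ⟨q, hΛ, htrace, hlength⟩ := ih h.2
    match q with
    | [] => exact absurd (htrace h.1) id
    | a :: l =>
      obtain ⟨l', hv, hsub, htrace', hlength'⟩ := exists_insert_mem_polygonalTrace l a (htrace h.1)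
      refine ⟨a :: l', fun x hx => ?_, htrace.trans htrace', hlength'.trans hlength⟩
      rcases Finset.mem_insert.1 hx with rfl | hx
      · exact hv
      · exact (hsub.cons_cons a).subset (hΛ x hx)

theorem exists_list_polygonalLength_le {s : Multiset ℂ} (hs : s.Nodup) {p : List ℂ}
    (h : {μ | μ ∈ s} ⊆ polygonalTrace p) :
    ∃ l : List ℂ, (l : Multiset ℂ) = s ∧ polygonalLength l ≤ polygonalLength p := by
  classical
  obtain ⟨q, hmem, -, hlength⟩ := exists_path_through_vertices s.toFinset p
    (by simpa [Set.subset_def] using h)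
  refine ⟨(q.filter (· ∈ s)).dedup, ?_, ?_⟩
  · rw [Multiset.Nodup.ext (Multiset.coe_nodup.2 (List.nodup_dedup _)) hs]
    intro x
    simp only [Multiset.mem_coe, List.mem_dedup, List.mem_filter, decide_eq_true_eq]
    exact ⟨fun hx => hx.2, fun hx => ⟨hmem x (Multiset.mem_toFinset.2 hx), hx⟩⟩
  · rw [← hlength]
    exact polygonalLength_le_of_sublist ((List.dedup_sublist _).trans List.filter_sublist)

theorem mem_subset_polygonalTrace (l : List ℂ) : {μ | μ ∈ l} ⊆ polygonalTrace l := by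
  fun_induction polygonalTrace l with
  | case1 | case2 => simp
  | case3 z w l ih =>
    rintro x hx
    rcases List.mem_cons.1 hx with rfl | hx
    · exact Or.inl (left_mem_segment ℝ _ _)
    · exact Or.inr (ih hx)

theorem shortestPathLength_nonneg (Λ : Set ℂ) : 0 ≤ shortestPathLength Λ :=
  Real.sInf_nonneg (by rintro _ ⟨p, -, rfl⟩; exact polygonalLength_nonneg p)

theorem shortestPathLength_empty : shortestPathLength ∅ = 0 := by
  refine le_antisymm (csInf_le ⟨0, ?_⟩ ⟨[], Set.empty_subset _, rfl⟩) (shortestPathLength_nonneg ∅)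
  rintro _ ⟨p, -, rfl⟩
  exact polygonalLength_nonneg p

theorem exists_list_polygonalLength_le_shortestPathLength {s : Multiset ℂ} (hs : s.Nodup) :
    ∃ l : List ℂ, (l : Multiset ℂ) = s ∧ polygonalLength l ≤ shortestPathLength {μ | μ ∈ s} := by
  classical
  have hfinite : {l : List ℂ | (l : Multiset ℂ) = s}.Finite :=
    s.lists.toFinset.finite_toSet.subset fun l hl =>
      Multiset.mem_toFinset.2 ((Multiset.mem_lists_iff s l).2 (Eq.symm hl))
  obtain ⟨l, hl, hmin⟩ := hfinite.exists_minimalFor polygonalLength _ ⟨s.toList, s.coe_toList⟩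
  refine ⟨l, hl, le_csInf ⟨_, s.toList, ?_, rfl⟩ ?_⟩
  · simpa using mem_subset_polygonalTrace s.toList
  · rintro _ ⟨p, hp, rfl⟩
    obtain ⟨q, hq, hqp⟩ := exists_list_polygonalLength_le hs hp
    exact ((le_total _ _).elim id (hmin hq)).trans hqp

end ShortestPath

section SimpleRoots

theorem sum_pow_le_of_zero_notMem {r : ℝ} (hr₀ : 0 ≤ r) (hr₁ : r < 1) {s : Finset ℕ}
    (hs : 0 ∉ s) : ∑ n ∈ s, r ^ n ≤ r / (1 - r) := by
  have htsum := (summable_geometric_of_lt_one hr₀ hr₁).sum_le_tsum (insert 0 s)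
    fun n _ => pow_nonneg hr₀ n
  rw [Finset.sum_insert hs, tsum_geometric_of_lt_one hr₀ hr₁, pow_zero] at htsum
  have hr : (1 - r) ≠ 0 := (sub_pos.2 hr₁).ne'
  have hsplit : (1 - r)⁻¹ = 1 + r / (1 - r) := by field_simp; ring
  linarith

theorem sum_erase_pow_dist_le {r : ℝ} (hr₀ : 0 ≤ r) (hr₁ : r < 1) {k : ℕ} (j : Fin k) :
    ∑ l ∈ Finset.univ.erase j, r ^ Nat.dist l j ≤ 2 * (r / (1 - r)) := by
  have hside : ∀ s : Finset (Fin k), j ∉ s →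
      (∀ l ∈ s, ∀ l' ∈ s, Nat.dist l j = Nat.dist l' j → l = l') →
      ∑ l ∈ s, r ^ Nat.dist l j ≤ r / (1 - r) := fun s hj hinj => by
    rw [← Finset.sum_image (g := fun l : Fin k => Nat.dist l j) (f := fun n => r ^ n) hinj]
    refine sum_pow_le_of_zero_notMem hr₀ hr₁ fun h0 => ?_
    obtain ⟨l, hl, hdist⟩ := Finset.mem_image.1 h0
    exact hj (Fin.ext (Nat.eq_of_dist_eq_zero hdist) ▸ hl)
  have hunion : Finset.univ.erase j = Finset.Iio j ∪ Finset.Ioi j := by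
    ext l
    simp
  rw [hunion, Finset.sum_union (Finset.disjoint_left.2 fun l hl hl' =>
    lt_asymm (Finset.mem_Iio.1 hl) (Finset.mem_Ioi.1 hl')), two_mul]
  refine add_le_add (hside _ (by simp) ?_) (hside _ (by simp) ?_) <;>
  · simp only [Finset.mem_Iio, Finset.mem_Ioi, Fin.lt_def, Fin.ext_iff, Nat.dist]
    omega

theorem sum_ne_zero_of_norm_le_mul {ι E : Type*} [DecidableEq ι] [NormedAddCommGroup E]
    {s : Finset ι} {v : ι → E} {j : ι} (hjs : j ∈ s) (hj : v j ≠ 0) {w : ι → ℝ}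
    (hv : ∀ l ∈ s.erase j, ‖v l‖ ≤ ‖v j‖ * w l) (hw : ∑ l ∈ s.erase j, w l < 1) :
    ∑ l ∈ s, v l ≠ 0 := fun h0 => by
  rw [← Finset.add_sum_erase _ _ hjs, add_eq_zero_iff_eq_neg] at h0
  refine (mul_lt_of_lt_one_right (norm_pos_iff.2 hj) hw).not_ge ?_
  calc ‖v j‖ = ‖∑ l ∈ s.erase j, v l‖ := by rw [h0, norm_neg]
    _ ≤ ∑ l ∈ s.erase j, ‖v j‖ * w l := norm_sum_le_of_le _ hv
    _ = _ := (Finset.mul_sum _ _ _).symm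

theorem norm_mul_exp_le {c d μ ν ζ : ℂ} {D t : ℝ}
    (h : ‖c‖ * Real.exp (μ.re * (ζ.re + D)) ≤ ‖d‖ * Real.exp (ν.re * (ζ.re + D)))
    (hD : t + |(μ.im - ν.im) * ζ.im| ≤ D * (μ.re - ν.re)) :
    ‖c * Complex.exp (μ * ζ)‖ ≤ ‖d * Complex.exp (ν * ζ)‖ * Real.exp (-t) := by
  simp only [norm_mul, Complex.norm_exp, Complex.mul_re]
  calc ‖c‖ * Real.exp (μ.re * ζ.re - μ.im * ζ.im)
      = ‖c‖ * Real.exp (μ.re * (ζ.re + D)) * Real.exp (-(μ.re * D) - μ.im * ζ.im) := by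
        rw [mul_assoc, ← Real.exp_add]
        ring_nf
    _ ≤ ‖d‖ * Real.exp (ν.re * (ζ.re + D)) * Real.exp (-(μ.re * D) - μ.im * ζ.im) := by gcongr
    _ = ‖d‖ * Real.exp (ν.re * (ζ.re + D) + (-(μ.re * D) - μ.im * ζ.im)) := by
        rw [mul_assoc, ← Real.exp_add]
    _ ≤ ‖d‖ * Real.exp (ν.re * ζ.re - ν.im * ζ.im + -t) := by
        refine mul_le_mul_of_nonneg_left (Real.exp_le_exp.2 ?_) (norm_nonneg d)
        linarith [neg_abs_le ((μ.im - ν.im) * ζ.im)]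
    _ = _ := by rw [Real.exp_add, mul_assoc]

theorem exists_monotone_dominant {ι : Type*} [LinearOrder ι] [Finite ι] [Nonempty ι] {h : ι → ℝ}
    (h₀ : 0 ≤ h) {ρ : ι → ℝ} (hρ : Monotone ρ) :
    ∃ J : ℝ → ι, Monotone J ∧
      ∀ x l, h l * Real.exp (ρ l * x) ≤ h (J x) * Real.exp (ρ (J x) * x) := by
  -- Ties are resolved in favour of the largest index.
  choose J hJ using fun x : ℝ =>
    Finite.exists_max fun l => toLex (h l * Real.exp (ρ l * x), l)
  have hmax : ∀ x l, h l * Real.exp (ρ l * x) ≤ h (J x) * Real.exp (ρ (J x) * x) := fun x l =>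
    (Prod.Lex.le_iff.1 (hJ x l)).elim le_of_lt fun h => h.1.le
  refine ⟨J, fun x x' hx => not_lt.1 fun hlt => ?_, hmax⟩
  have hstrict : h (J x) * Real.exp (ρ (J x) * x') < h (J x') * Real.exp (ρ (J x') * x') :=
    (Prod.Lex.le_iff.1 (hJ x' (J x))).resolve_right fun h => h.2.not_gt hlt
  have hexp : ∀ l, h l * Real.exp (ρ l * x') =
      h l * Real.exp (ρ l * x) * Real.exp (ρ l * (x' - x)) := fun l => by
    rw [mul_assoc, ← Real.exp_add]
    ring_nf
  rw [hexp, hexp] at hstrict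
  refine hstrict.not_ge (mul_le_mul (hmax x _) (Real.exp_le_exp.2 ?_) (Real.exp_pos _).le
    (mul_nonneg (h₀ _) (Real.exp_pos _).le))
  exact mul_le_mul_of_nonneg_right (hρ hlt.le) (sub_nonneg.2 hx)

theorem reCoverable_jumps {k : ℕ} {J : ℝ → Fin k} (hJ : Monotone J) (D : ℝ) :
    ReCoverable {ζ | J (ζ.re - D) < J (ζ.re + D)} (k - 1) D := by
  classical
  refine ⟨(Finset.range (k - 1)).image fun i => sInf {x | i < (J x : ℕ)},
    Finset.card_image_le.trans (Finset.card_range _).le, fun ζ hζ => ?_⟩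
  have hjump : (J (ζ.re - D) : ℕ) < J (ζ.re + D) := hζ
  refine ⟨_, Finset.mem_image_of_mem _ (Finset.mem_range.2 (by omega : (J (ζ.re - D) : ℕ) < _)), ?_⟩
  have hlower : ζ.re - D ∈ lowerBounds {x | (J (ζ.re - D) : ℕ) < J x} := fun x hx =>
    not_lt.1 fun hlt => (hJ hlt.le).not_gt hx
  have hle := csInf_le ⟨_, hlower⟩ hjump
  have hge := le_csInf ⟨ζ.re + D, hjump⟩ hlower
  exact abs_le.2 ⟨by linarith, by linarith⟩

variable {k : ℕ} {lam : Fin k → ℂ}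

theorem rootTheta_nonneg (lam : Fin k → ℂ) : 0 ≤ rootTheta lam :=
  Real.iSup_nonneg fun _ => inv_nonneg.2 (abs_nonneg _)

theorem rootXi_nonneg (lam : Fin k → ℂ) : 0 ≤ rootXi lam :=
  Real.iSup_nonneg fun _ => abs_nonneg _

theorem mul_rootXi_add_rootTheta_mul_log_nonneg {α : ℝ} (hα : 0 ≤ α) (lam : Fin k → ℂ) :
    0 ≤ α * rootXi lam + rootTheta lam * Real.log 4 :=
  add_nonneg (mul_nonneg hα (rootXi_nonneg lam))
    (mul_nonneg (rootTheta_nonneg lam) (Real.log_nonneg (by norm_num)))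

theorem one_le_rootTheta_mul (hlam : StrictMono fun j => (lam j).re) {i : ℕ} (hi : i + 1 < k) :
    1 ≤ rootTheta lam * ((lam ⟨i + 1, hi⟩).re - (lam ⟨i, by omega⟩).re) := by
  have hgap : (lam ⟨i, by omega⟩).re < (lam ⟨i + 1, hi⟩).re := hlam (Fin.mk_lt_mk.2 i.lt_succ_self)
  rw [← inv_le_iff_one_le_mul₀ (sub_pos.2 hgap), ← abs_of_pos (sub_pos.2 hgap), abs_sub_comm]
  exact le_ciSup (f := fun j : Fin (k - 1) =>
    |(lam ⟨j, by omega⟩).re - (lam ⟨j + 1, by omega⟩).re|⁻¹)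
    (Set.finite_range _).bddAbove ⟨i, by omega⟩

theorem abs_im_sub_succ_le_rootXi_mul (hlam : StrictMono fun j => (lam j).re) {i : ℕ}
    (hi : i + 1 < k) :
    |(lam ⟨i + 1, hi⟩).im - (lam ⟨i, by omega⟩).im| ≤
      rootXi lam * ((lam ⟨i + 1, hi⟩).re - (lam ⟨i, by omega⟩).re) := by
  have hgap : (lam ⟨i, by omega⟩).re < (lam ⟨i + 1, hi⟩).re := hlam (Fin.mk_lt_mk.2 i.lt_succ_self)
  rw [← div_le_iff₀ (sub_pos.2 hgap)]
  nth_rw 1 [← abs_of_pos (sub_pos.2 hgap), abs_sub_comm, abs_sub_comm (lam _).re, ← abs_div]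
  exact le_ciSup (f := fun j : Fin (k - 1) =>
    |((lam ⟨j, by omega⟩).im - (lam ⟨j + 1, by omega⟩).im) /
      ((lam ⟨j, by omega⟩).re - (lam ⟨j + 1, by omega⟩).re)|)
    (Set.finite_range _).bddAbove ⟨i, by omega⟩

theorem dist_mul_log_add_abs_im_le (hlam : StrictMono fun j => (lam j).re) {i j : Fin k}
    (hij : i ≤ j) {α y : ℝ} (hy : |y| ≤ α) :
    Nat.dist j i * Real.log 4 + |((lam j).im - (lam i).im) * y| ≤
      (α * rootXi lam + rootTheta lam * Real.log 4) * ((lam j).re - (lam i).re) := by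
  obtain ⟨j, hj⟩ := j
  induction j, (show (i : ℕ) ≤ j from hij) using Nat.le_induction with
  | base => simp
  | succ n hn ih =>
    have hprev := ih (by omega) hn
    set μ := lam ⟨n, by omega⟩
    set ν := lam ⟨n + 1, hj⟩
    have hre : Real.log 4 ≤ rootTheta lam * (ν.re - μ.re) * Real.log 4 :=
      le_mul_of_one_le_left (Real.log_nonneg (by norm_num)) (one_le_rootTheta_mul hlam hj)
    have him : |(ν.im - μ.im) * y| ≤ rootXi lam * (ν.re - μ.re) * α := by
      have hΞ := abs_im_sub_succ_le_rootXi_mul hlam hj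
      rw [abs_mul]
      exact mul_le_mul hΞ hy (abs_nonneg y) ((abs_nonneg _).trans hΞ)
    have htri : |(ν.im - (lam i).im) * y| ≤
        |(ν.im - μ.im) * y| + |(μ.im - (lam i).im) * y| := by
      rw [← sub_add_sub_cancel ν.im μ.im, add_mul]
      exact abs_add_le _ _
    rw [show Nat.dist (n + 1) i = Nat.dist n i + 1 by simp only [Nat.dist]; omega]
    push_cast
    linarith

theorem norm_mul_exp_le_mul_pow_dist (hlam : StrictMono fun j => (lam j).re) {c : Fin k → ℂ}
    {α D : ℝ} (hD : D = α * rootXi lam + rootTheta lam * Real.log 4) {ζ : ℂ}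
    (hζ : ζ ∈ horizontalStrip α) {j : Fin k}
    (hup : ∀ l, ‖c l‖ * Real.exp ((lam l).re * (ζ.re + D)) ≤
      ‖c j‖ * Real.exp ((lam j).re * (ζ.re + D)))
    (hdown : ∀ l, ‖c l‖ * Real.exp ((lam l).re * (ζ.re - D)) ≤
      ‖c j‖ * Real.exp ((lam j).re * (ζ.re - D))) (l : Fin k) :
    ‖c l * Complex.exp (lam l * ζ)‖ ≤
      ‖c j * Complex.exp (lam j * ζ)‖ * (1 / 4) ^ Nat.dist l j := by
  have hpow : ∀ n : ℕ, (1 / 4 : ℝ) ^ n = Real.exp (-(n * Real.log 4)) := fun n => by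
    rw [← mul_neg, ← Real.log_inv, Real.exp_nat_mul, Real.exp_log (by norm_num), one_div]
  rw [hpow]
  rcases le_total j l with hjl | hlj
  · exact norm_mul_exp_le (hup l) (hD ▸ dist_mul_log_add_abs_im_le hlam hjl hζ)
  · refine norm_mul_exp_le (D := -D) (hdown l) ?_
    have hpair := dist_mul_log_add_abs_im_le hlam hlj hζ
    rw [← hD, ← abs_neg, Nat.dist_comm] at hpair
    convert hpair using 1 <;> ring_nf

theorem reCoverable_zeros_of_strictMono_re (hlam : StrictMono fun j => (lam j).re) {c : Fin k → ℂ}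
    (hc : c ≠ 0) (α : ℝ) :
    ReCoverable (horizontalStrip α ∩ {ζ | ∑ j, c j * Complex.exp (lam j * ζ) = 0}) (k - 1)
      (α * rootXi lam + rootTheta lam * Real.log 4) := by
  set D := α * rootXi lam + rootTheta lam * Real.log 4 with hD
  obtain ⟨j₀, hj₀⟩ := Function.ne_iff.1 hc
  have : Nonempty (Fin k) := ⟨j₀⟩
  obtain ⟨J, hmono, hJ⟩ := exists_monotone_dominant (fun j => norm_nonneg (c j)) hlam.monotone
  obtain ⟨s, hcard, hs⟩ := reCoverable_jumps hmono D
  refine ⟨s, hcard, fun ζ ⟨hζ, h0⟩ => hs ζ <| show J _ < J _ from not_le.1 fun hle => ?_⟩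
  have hD₀ : 0 ≤ D := mul_rootXi_add_rootTheta_mul_log_nonneg ((abs_nonneg _).trans hζ) lam
  have hstable : J (ζ.re + D) = J (ζ.re - D) := hle.antisymm (hmono (by linarith))
  set j := J (ζ.re - D)
  have hcj : c j ≠ 0 := norm_pos_iff.1 (pos_of_mul_pos_left
    ((by positivity : 0 < ‖c j₀‖ * _).trans_le (hJ (ζ.re - D) j₀)) (Real.exp_pos _).le)
  refine sum_ne_zero_of_norm_le_mul (v := fun l => c l * Complex.exp (lam l * ζ))
    (Finset.mem_univ j) (mul_ne_zero hcj (Complex.exp_ne_zero _)) (fun l _ =>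
    norm_mul_exp_le_mul_pow_dist hlam hD hζ (fun i => ?_) (hJ _) l) ?_ h0
  · exact (hJ (ζ.re + D) i).trans_eq (by rw [hstable])
  · exact (sum_erase_pow_dist_le (by norm_num) (by norm_num) j).trans_lt (by norm_num)

end SimpleRoots

section MultipleRoots

theorem norm_eval_eq_prod_roots (p : ℂ[X]) (z : ℂ) :
    ‖p.eval z‖ = ‖p.leadingCoeff‖ * (p.roots.map fun w => ‖z - w‖).prod := by
  conv_lhs => rw [(IsAlgClosed.splits p).eq_prod_roots]
  rw [eval_mul, eval_C, eval_multiset_prod, norm_mul, Multiset.map_map]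
  refine congrArg (‖p.leadingCoeff‖ * ·) ?_
  exact (map_multiset_prod (normHom : ℂ →*₀ ℝ) _).trans (by simp [normHom])

theorem norm_eval_le_mul_exp {p : ℂ[X]} {k : ℕ} (hp : p.natDegree ≤ k) {δ : ℝ} (hδ : 0 < δ)
    {z : ℂ} (hz : ∀ w ∈ p.roots, δ ≤ ‖z - w‖) (z' : ℂ) :
    ‖p.eval z'‖ ≤ ‖p.eval z‖ * Real.exp (k * (‖z' - z‖ / δ)) := by
  set r := ‖z' - z‖ / δ with hr
  have hr₀ : 0 ≤ r := by positivity
  have hfactor : ∀ w ∈ p.roots, ‖z' - w‖ ≤ ‖z - w‖ * Real.exp r := fun w hw =>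
    calc ‖z' - w‖ ≤ δ * r + ‖z - w‖ := by
          rw [hr, mul_div_cancel₀ _ hδ.ne']
          exact norm_sub_le_norm_sub_add_norm_sub _ _ _
      _ ≤ ‖z - w‖ * r + ‖z - w‖ := by
          gcongr
          exact hz w hw
      _ = ‖z - w‖ * (r + 1) := by ring
      _ ≤ ‖z - w‖ * Real.exp r := by
          gcongr
          exact Real.add_one_le_exp r
  have hcard : p.roots.card ≤ k := (card_roots' p).trans hp
  rw [norm_eval_eq_prod_roots, norm_eval_eq_prod_roots, mul_assoc]
  refine mul_le_mul_of_nonneg_left ?_ (norm_nonneg _)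
  calc (p.roots.map fun w => ‖z' - w‖).prod
      ≤ (p.roots.map fun w => ‖z - w‖ * Real.exp r).prod :=
        Multiset.prod_map_le_prod_map₀ _ _ (fun w _ => norm_nonneg _) hfactor
    _ = (p.roots.map fun w => ‖z - w‖).prod * Real.exp r ^ p.roots.card := by
        rw [Multiset.prod_map_mul, Multiset.map_const', Multiset.prod_replicate]
    _ ≤ (p.roots.map fun w => ‖z - w‖).prod * Real.exp (k * r) := by
        rw [Real.exp_nat_mul]
        refine mul_le_mul_of_nonneg_left (pow_le_pow_right₀ (Real.one_le_exp hr₀) hcard)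
          (Multiset.prod_nonneg fun x hx => ?_)
        obtain ⟨w, -, rfl⟩ := Multiset.mem_map.1 hx
        exact norm_nonneg _

theorem exp_re_sub_mul_sub_le {a a' b b' μ ν ζ ζ' : ℂ} {K E : ℝ} (hK : 0 ≤ K) (hE : 0 ≤ E)
    (hb : b ≠ 0) (haE : ‖a'‖ ≤ ‖a‖ * E) (hbE : ‖b‖ ≤ ‖b'‖ * E)
    (h : ‖a * Complex.exp (μ * ζ)‖ ≤ K * ‖b * Complex.exp (ν * ζ)‖)
    (h' : ‖b' * Complex.exp (ν * ζ')‖ ≤ K * ‖a' * Complex.exp (μ * ζ')‖) :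
    Real.exp ((ν - μ) * (ζ' - ζ)).re ≤ (K * E) ^ 2 := by
  have hsplit : ∀ σ : ℂ, Complex.exp (σ * ζ') =
      Complex.exp (σ * ζ) * Complex.exp (σ * (ζ' - ζ)) := fun σ => by
    rw [← Complex.exp_add]
    ring_nf
  rw [norm_mul, norm_mul] at h h'
  set B := ‖b‖ * ‖Complex.exp (ν * ζ)‖ * ‖Complex.exp (μ * (ζ' - ζ))‖
  have hB : 0 < B := mul_pos (mul_pos (norm_pos_iff.2 hb)
    (norm_pos_iff.2 (Complex.exp_ne_zero _))) (norm_pos_iff.2 (Complex.exp_ne_zero _))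
  refine le_of_mul_le_mul_left ?_ hB
  calc B * Real.exp ((ν - μ) * (ζ' - ζ)).re
      = ‖b‖ * ‖Complex.exp (ν * ζ')‖ := by
        rw [hsplit ν, ← sub_add_cancel ν μ, add_mul _ μ (ζ' - ζ), Complex.exp_add, norm_mul,
          norm_mul, Complex.norm_exp ((ν - μ) * _), sub_add_cancel]
        simp only [B]
        ring
    _ ≤ ‖b'‖ * E * ‖Complex.exp (ν * ζ')‖ := by gcongr
    _ = ‖b'‖ * ‖Complex.exp (ν * ζ')‖ * E := by ring
    _ ≤ K * (‖a'‖ * ‖Complex.exp (μ * ζ')‖) * E := by gcongr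
    _ ≤ K * (‖a‖ * E * ‖Complex.exp (μ * ζ')‖) * E := by gcongr
    _ = ‖a‖ * ‖Complex.exp (μ * ζ)‖ * ‖Complex.exp (μ * (ζ' - ζ))‖ * (K * E ^ 2) := by
        rw [hsplit μ, norm_mul]
        ring
    _ ≤ K * (‖b‖ * ‖Complex.exp (ν * ζ)‖) * ‖Complex.exp (μ * (ζ' - ζ))‖ * (K * E ^ 2) := by
        gcongr
    _ = B * (K * E) ^ 2 := by ring

variable {p q : ℂ[X]} {k : ℕ} {μ ν : ℂ} {α δ K : ℝ}

theorem re_sub_mul_sub_le_of_comparable (hp : p.natDegree ≤ k) (hq : q.natDegree ≤ k)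
    (hδ : 0 < δ) (hK : 0 < K) {ζ ζ' : ℂ} (hpζ : ∀ w ∈ p.roots, δ ≤ ‖ζ - w‖)
    (hqζ' : ∀ w ∈ q.roots, δ ≤ ‖ζ' - w‖) (hqζ : q.eval ζ ≠ 0)
    (h : ‖p.eval ζ * Complex.exp (μ * ζ)‖ ≤ K * ‖q.eval ζ * Complex.exp (ν * ζ)‖)
    (h' : ‖q.eval ζ' * Complex.exp (ν * ζ')‖ ≤ K * ‖p.eval ζ' * Complex.exp (μ * ζ')‖) :
    ((ν - μ) * (ζ' - ζ)).re ≤ 2 * (Real.log K + k * (‖ζ' - ζ‖ / δ)) := by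
  have hqE := norm_eval_le_mul_exp hq hδ hqζ' ζ
  rw [norm_sub_rev ζ ζ'] at hqE
  have hlog := Real.log_le_log (Real.exp_pos _) (exp_re_sub_mul_sub_le hK.le (Real.exp_pos _).le
    hqζ (norm_eval_le_mul_exp hp hδ hpζ ζ') hqE h h')
  rw [Real.log_exp, Real.log_pow, Real.log_mul hK.ne' (Real.exp_ne_zero _), Real.log_exp] at hlog
  exact_mod_cast hlog

theorem re_le_of_re_mul_le {ω u : ℂ} (hω : 0 < ω.re) (him : |u.im| ≤ 2 * α)
    {c t : ℝ} (hc : c ≤ ω.re / 4) (hre : 0 ≤ u.re)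
    (h : (ω * u).re ≤ 2 * (t + c * ‖u‖)) :
    u.re ≤ 4 / ω.re * (t + α * (|ω.im| + ω.re / 2)) := by
  have hnorm : ‖u‖ ≤ u.re + 2 * α := (Complex.norm_le_abs_re_add_abs_im u).trans
    (add_le_add (abs_of_nonneg hre).le him)
  have hc : c * ‖u‖ ≤ ω.re / 4 * (u.re + 2 * α) :=
    mul_le_mul hc hnorm (norm_nonneg u) (by positivity)
  have hrot : ω.im * u.im ≤ |ω.im| * (2 * α) := (le_abs_self _).trans
    ((abs_mul _ _).trans_le (mul_le_mul_of_nonneg_left him (abs_nonneg _)))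
  rw [Complex.mul_re] at h
  rw [div_mul_eq_mul_div, le_div_iff₀ hω]
  linarith

theorem ReCoverable.mono {Z Z' : Set ℂ} {N N' : ℕ} {D D' : ℝ} (h : ReCoverable Z' N D)
    (hZ : Z ⊆ Z') (hN : N ≤ N') (hD : D ≤ D') : ReCoverable Z N' D' :=
  h.imp fun _ ⟨hcard, hs⟩ => ⟨hcard.trans hN, fun ζ hζ =>
    (hs ζ (hZ hζ)).imp fun _ hb => ⟨hb.1, hb.2.trans hD⟩⟩

theorem ReCoverable.union {Z Z' : Set ℂ} {N N' : ℕ} {D : ℝ} (h : ReCoverable Z N D)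
    (h' : ReCoverable Z' N' D) : ReCoverable (Z ∪ Z') (N + N') D := by
  classical
  obtain ⟨s, hcard, hs⟩ := h
  obtain ⟨s', hcard', hs'⟩ := h'
  refine ⟨s ∪ s', (Finset.card_union_le s s').trans (add_le_add hcard hcard'), ?_⟩
  rintro ζ (hζ | hζ)
  · exact (hs ζ hζ).imp fun b hb => ⟨Finset.mem_union_left s' hb.1, hb.2⟩
  · exact (hs' ζ hζ).imp fun b hb => ⟨Finset.mem_union_right s hb.1, hb.2⟩

theorem ReCoverable.biUnion {ι : Type*} {t : Finset ι} {Z : ι → Set ℂ} {N : ℕ} {D : ℝ}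
    (h : ∀ i ∈ t, ReCoverable (Z i) N D) : ReCoverable (⋃ i ∈ t, Z i) (t.card * N) D := by
  classical
  choose! s hcard hs using h
  refine ⟨t.biUnion s, Finset.card_biUnion_le_card_mul _ _ _ hcard, fun ζ hζ => ?_⟩
  obtain ⟨i, hi, hζi⟩ := Set.mem_iUnion₂.1 hζ
  exact (hs i hi ζ hζi).imp fun b hb => ⟨Finset.mem_biUnion.2 ⟨i, hi, hb.1⟩, hb.2⟩

theorem reCoverable_one_of_re_sub_le {Z : Set ℂ} {D : ℝ}
    (h : ∀ ζ ∈ Z, ∀ ζ' ∈ Z, ζ.re ≤ ζ'.re → ζ'.re - ζ.re ≤ D) : ReCoverable Z 1 D := by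
  rcases Z.eq_empty_or_nonempty with rfl | ⟨ζ, hζ⟩
  · exact ⟨∅, by simp, fun ζ hζ => absurd hζ (Set.notMem_empty ζ)⟩
  refine ⟨{ζ.re}, (Finset.card_singleton _).le, fun ζ' hζ' =>
    ⟨ζ.re, Finset.mem_singleton_self _, ?_⟩⟩
  rcases le_total ζ.re ζ'.re with hle | hle
  · exact (abs_of_nonneg (sub_nonneg.2 hle)).trans_le (h ζ hζ ζ' hζ' hle)
  · exact (abs_sub_comm _ _).trans_le
      ((abs_of_nonneg (sub_nonneg.2 hle)).trans_le (h ζ' hζ' ζ hζ hle))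

theorem reCoverable_near_roots (hp : p.natDegree ≤ k) (δ : ℝ) :
    ReCoverable {ζ | ∃ w ∈ p.roots, ‖ζ - w‖ ≤ δ} k δ := by
  classical
  refine ⟨p.roots.toFinset.image Complex.re, Finset.card_image_le.trans
    ((Multiset.toFinset_card_le _).trans ((card_roots' p).trans hp)), ?_⟩
  rintro ζ ⟨w, hw, hζ⟩
  exact ⟨w.re, Finset.mem_image_of_mem _ (Multiset.mem_toFinset.2 hw),
    (Complex.abs_re_le_norm (ζ - w)).trans hζ⟩

/-- The points where the exponential monomials `p e ^ (μ z)` and `q e ^ (ν z)` do not vanish and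
have the same size up to the factor `K`. -/
def comparableSet (K : ℝ) (p q : ℂ[X]) (μ ν : ℂ) : Set ℂ :=
  {ζ | q.eval ζ ≠ 0 ∧ ‖p.eval ζ * Complex.exp (μ * ζ)‖ ≤ K * ‖q.eval ζ * Complex.exp (ν * ζ)‖ ∧
    ‖q.eval ζ * Complex.exp (ν * ζ)‖ ≤ K * ‖p.eval ζ * Complex.exp (μ * ζ)‖}

theorem exists_reCoverable_comparableSet (α : ℝ) (k : ℕ) (hK : 0 < K) (hre : μ.re < ν.re) :
    ∃ D, ∀ p q : ℂ[X], p.natDegree ≤ k → q.natDegree ≤ k →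
      ReCoverable (horizontalStrip α ∩ comparableSet K p q μ ν) (k + k + 1) D := by
  have hω : 0 < (ν - μ).re := sub_pos.2 hre
  set δ := 4 * (k + 1) / (ν - μ).re with hδ
  have hδ₀ : 0 < δ := by positivity
  set H := 4 / (ν - μ).re * (Real.log K + α * (|(ν - μ).im| + (ν - μ).re / 2))
  refine ⟨max δ H, fun p q hp hq => ?_⟩
  set far := {ζ | (∀ w ∈ p.roots, δ ≤ ‖ζ - w‖) ∧ ∀ w ∈ q.roots, δ ≤ ‖ζ - w‖}
  have hfar : ReCoverable (far ∩ (horizontalStrip α ∩ comparableSet K p q μ ν)) 1 H := by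
    refine reCoverable_one_of_re_sub_le fun ζ ⟨hfar, hα, h0, hle, _⟩ ζ' ⟨hfar', hα', _, _, hle'⟩
      hζ => ?_
    refine re_le_of_re_mul_le hω (u := ζ' - ζ) (c := k / δ) ?_ ?_ (sub_nonneg.2 hζ) ?_
    · exact (abs_sub _ _).trans ((add_le_add hα' hα).trans_eq (two_mul α).symm)
    · rw [hδ, div_le_iff₀ (by positivity)]
      field_simp
      linarith
    · rw [div_mul_eq_mul_div, ← mul_div_assoc']
      exact re_sub_mul_sub_le_of_comparable hp hq hδ₀ hK hfar.1 hfar'.2 h0 hle hle'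
  refine ((((reCoverable_near_roots hp δ).union (reCoverable_near_roots hq δ)).mono subset_rfl
    le_rfl (le_max_left δ H)).union (hfar.mono subset_rfl le_rfl (le_max_right δ H))).mono
    (fun ζ hζ => ?_) le_rfl le_rfl
  by_cases hζfar : ζ ∈ far
  · exact Or.inr ⟨hζfar, hζ⟩
  · simp only [far, Set.mem_ofPred_eq, not_and_or, not_forall, not_le, exists_prop] at hζfar
    exact Or.inl (hζfar.imp (fun ⟨w, hw, h⟩ => ⟨w, hw, h.le⟩) fun ⟨w, hw, h⟩ => ⟨w, hw, h.le⟩)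

theorem exists_comparable_of_sum_eq_zero {ι E : Type*} [NormedAddCommGroup E] {s : Finset ι}
    {v : ι → E} {i₀ : ι} (hi₀ : i₀ ∈ s) (hv : v i₀ ≠ 0) (h0 : ∑ i ∈ s, v i = 0) :
    ∃ i ∈ s, ∃ j ∈ s, i ≠ j ∧ v j ≠ 0 ∧ v i ≠ 0 ∧ ‖v i‖ ≤ s.card * ‖v j‖ ∧
      ‖v j‖ ≤ s.card * ‖v i‖ := by
  classical
  obtain ⟨i, hi, hmax⟩ := s.exists_max_image (fun i => ‖v i‖) ⟨i₀, hi₀⟩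
  have hvi : v i ≠ 0 := norm_pos_iff.1 ((norm_pos_iff.2 hv).trans_le (hmax i₀ hi₀))
  have hcard : (1 : ℝ) ≤ s.card := Nat.one_le_cast.2 (Finset.card_pos.2 ⟨i, hi⟩)
  obtain ⟨j, hj, hlt⟩ : ∃ j ∈ s.erase i, ‖v i‖ * (s.card : ℝ)⁻¹ < ‖v j‖ := by
    by_contra! hle
    refine sum_ne_zero_of_norm_le_mul hi hvi hle ?_ h0
    rw [Finset.sum_const, Finset.card_erase_of_mem hi, nsmul_eq_mul,
      Nat.cast_pred (Finset.card_pos.2 ⟨i, hi⟩), mul_inv_lt_iff₀ (by positivity)]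
    linarith
  obtain ⟨hji, hjs⟩ := Finset.mem_erase.1 hj
  rw [mul_inv_lt_iff₀ (by positivity), mul_comm] at hlt
  have hvj : v j ≠ 0 := fun h => hlt.not_ge (by simp [h])
  exact ⟨i, hi, j, hjs, hji.symm, hvj, hvi, hlt.le,
    (hmax j hjs).trans (le_mul_of_one_le_left (norm_nonneg _) hcard)⟩

theorem zeros_subset_biUnion_comparableSet {T : Finset ℂ} (hT : Set.InjOn Complex.re T)
    {P : ℂ → ℂ[X]} (hμ : μ ∈ T) (hP : P μ ≠ 0) :
    {ζ | ∑ μ ∈ T, (P μ).eval ζ * Complex.exp (μ * ζ) = 0} ⊆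
      {ζ | ∃ w ∈ (P μ).roots, ‖ζ - w‖ ≤ 0} ∪
        ⋃ x ∈ (T ×ˢ T).filter fun x => x.1.re < x.2.re,
          comparableSet T.card (P x.1) (P x.2) x.1 x.2 := fun ζ hζ => by
  by_cases h0 : (P μ).eval ζ = 0
  · exact Or.inl ⟨ζ, (mem_roots hP).2 h0, by simp⟩
  obtain ⟨i, hi, j, hj, hij, hj0, hi0, hle, hle'⟩ := exists_comparable_of_sum_eq_zero
    (v := fun μ => (P μ).eval ζ * Complex.exp (μ * ζ)) hμ
    (mul_ne_zero h0 (Complex.exp_ne_zero _)) hζ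
  refine Or.inr (Set.mem_iUnion₂.2 ?_)
  rcases lt_or_gt_of_ne fun h => hij (hT hi hj h) with hre | hre
  · exact ⟨(i, j), by simp [hi, hj, hre], left_ne_zero_of_mul hj0, hle, hle'⟩
  · exact ⟨(j, i), by simp [hi, hj, hre], left_ne_zero_of_mul hi0, hle', hle⟩

theorem exists_reCoverable_zeros {T : Finset ℂ} (hT : Set.InjOn Complex.re T) (k : ℕ) (α : ℝ) :
    ∃ N D, 0 ≤ D ∧ ∀ P : ℂ → ℂ[X], (∀ μ, (P μ).natDegree ≤ k) → (∃ μ ∈ T, P μ ≠ 0) →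
      ReCoverable (horizontalStrip α ∩ {ζ | ∑ μ ∈ T, (P μ).eval ζ * Complex.exp (μ * ζ) = 0})
        N D := by
  rcases T.eq_empty_or_nonempty with rfl | hne
  · exact ⟨0, 0, le_rfl, by simp⟩
  have hK : (0 : ℝ) < T.card := Nat.cast_pos.2 hne.card_pos
  choose! D hD using fun μ ν => exists_reCoverable_comparableSet (μ := μ) (ν := ν) α k hK
  obtain ⟨B, hB⟩ := ((T ×ˢ T).image fun x => D x.1 x.2).exists_le
  refine ⟨k + ((T ×ˢ T).filter fun x => x.1.re < x.2.re).card * (k + k + 1), max B 0,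
    le_max_right B 0, fun P hP ⟨μ, hμ, hμ0⟩ => ?_⟩
  have hpairs := ReCoverable.biUnion (t := (T ×ˢ T).filter fun x => x.1.re < x.2.re)
    (D := max B 0) (N := k + k + 1)
    (Z := fun x => horizontalStrip α ∩ comparableSet T.card (P x.1) (P x.2) x.1 x.2) fun x hx => by
      obtain ⟨hxT, hre⟩ := Finset.mem_filter.1 hx
      exact (hD x.1 x.2 hre _ _ (hP _) (hP _)).mono subset_rfl le_rfl
        ((hB _ (Finset.mem_image_of_mem _ hxT)).trans (le_max_left B 0))
  refine (((reCoverable_near_roots (hP μ) 0).mono subset_rfl le_rfl (le_max_right B 0)).union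
    hpairs).mono (fun ζ ⟨hα, hζ⟩ => ?_) le_rfl le_rfl
  refine (zeros_subset_biUnion_comparableSet hT hμ hμ0 hζ).imp_right fun h => ?_
  obtain ⟨x, hx, hζx⟩ := Set.mem_iUnion₂.1 h
  exact Set.mem_iUnion₂.2 ⟨x, hx, hα, hζx⟩

end MultipleRoots

section ZeroBounds

variable {k : ℕ} {a : Fin (k + 1) → ℂ} {α : ℝ} {lam : Fin k → ℂ} {y : ℂ → ℂ}

theorem aeval_entireDeriv_list_prod_eq_zero (ha : a (Fin.last k) ≠ 0) (hy : IsODESolution a y)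
    {p : List ℂ} (hp : (p : Multiset ℂ) = (odeCharPoly a).roots) :
    aeval entireDeriv (p.map fun μ => X - C μ).prod (⟨y, hy.1⟩ : entireFunctions) = 0 := by
  rw [← Multiset.prod_coe, ← Multiset.map_coe, hp]
  exact aeval_entireDeriv_roots_eq_zero ha hy

theorem exists_zeroCount_le (hα : 0 ≤ α) (ha : a (Fin.last k) ≠ 0)
    (hroots : Set.InjOn Complex.re {μ | μ ∈ (odeCharPoly a).roots}) :
    ∃ N : ℕ, ∀ y : ℂ → ℂ, IsODESolution a y → y ≠ 0 →
      zeroCount y (horizontalStrip α) ≤ (N : ℕ∞) := by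
  classical
  obtain ⟨N, D, hD, hcover⟩ := exists_reCoverable_zeros
    (T := (odeCharPoly a).roots.toFinset) (by simpa [Set.InjOn] using hroots) k α
  refine ⟨_, fun y hy hne => zeroCount_horizontalStrip_le (p := (odeCharPoly a).roots.toList)
    (f := ⟨y, hy.1⟩) (N := N) (fun h => hne (congrArg Subtype.val h))
    (aeval_entireDeriv_list_prod_eq_zero ha hy (Multiset.coe_toList _)) hα hD ?_⟩
  obtain ⟨P, hP, hsum⟩ := exists_eq_sum_eval_mul_exp (aeval_entireDeriv_roots_eq_zero ha hy)
  have hdeg : ∀ μ, (P μ).natDegree ≤ k := fun μ => natDegree_le_of_degree_le <| (hP μ).le.trans <|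
    Nat.cast_le.2 ((Multiset.count_le_card μ _).trans_eq (card_roots_odeCharPoly ha))
  refine (hcover P hdeg ?_).mono (fun ζ ⟨hζ, h0⟩ => ⟨hζ, (hsum ζ).symm.trans h0⟩) le_rfl le_rfl
  by_contra! h0
  exact hne (funext fun z => (hsum z).trans (Finset.sum_eq_zero fun μ hμ => by simp [h0 μ hμ]))

theorem setOf_mem_roots_eq_range (hlam : (odeCharPoly a).roots = Multiset.map lam Finset.univ.val) :
    {μ | μ ∈ (odeCharPoly a).roots} = Set.range lam := by
  ext
  simp [hlam]

theorem IsODESolution.exists_eq_sum_mul_exp (hy : IsODESolution a y) (ha : a (Fin.last k) ≠ 0)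
    (hlam : (odeCharPoly a).roots = Multiset.map lam Finset.univ.val)
    (hinj : Function.Injective lam) :
    ∃ c : Fin k → ℂ, ∀ z, y z = ∑ j, c j * Complex.exp (lam j * z) := by
  classical
  obtain ⟨P, hP, hsum⟩ := exists_eq_sum_eval_mul_exp (aeval_entireDeriv_roots_eq_zero ha hy)
  rw [hlam] at hP hsum
  have hconst : ∀ μ, P μ = C ((P μ).coeff 0) := fun μ =>
    eq_C_of_degree_le_zero <| Nat.WithBot.lt_one_iff_le_zero.1 <| (hP μ).trans_le <|
      Nat.cast_le.2 (Multiset.nodup_iff_count_le_one.1 (Finset.univ.nodup.map hinj) μ)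
  refine ⟨fun j => (P (lam j)).coeff 0, fun z => (hsum z).trans ?_⟩
  rw [Multiset.toFinset_map, Finset.val_toFinset, Finset.sum_image hinj.injOn]
  exact Finset.sum_congr rfl fun j _ => by conv_lhs => rw [hconst (lam j), eval_C]

/-- The upper bound for the number of zeros in the strip of half-width `α` when the
characteristic roots `lam` are simple. -/
noncomputable def simpleRootsBound (α : ℝ) (lam : Fin k → ℂ) : ℝ :=
  ((k : ℝ) - 1) ^ 2 + 2 / Real.pi * ((k : ℝ) - 1) * shortestPathLength (Set.range lam) *
    (α * (rootXi lam + 2) + rootTheta lam * Real.log 4)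

theorem simpleRootsBound_nonneg (hα : 0 ≤ α) (lam : Fin k → ℂ) : 0 ≤ simpleRootsBound α lam := by
  rw [simpleRootsBound]
  rcases Nat.eq_zero_or_pos k with rfl | hk
  · rw [Set.range_eq_empty, shortestPathLength_empty]
    norm_num
  · have hk : 0 ≤ (k : ℝ) - 1 := sub_nonneg.2 (Nat.one_le_cast.2 hk)
    have := Real.log_nonneg (show (1 : ℝ) ≤ 4 by norm_num)
    have := shortestPathLength_nonneg (Set.range lam)
    have := rootXi_nonneg lam
    have := rootTheta_nonneg lam
    positivity

theorem mul_floor_le_simpleRootsBound (hα : 0 ≤ α) (hk : 1 ≤ k) {L : ℝ}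
    (hL : L ≤ shortestPathLength (Set.range lam)) :
    (((k - 1) * ⌊(k : ℝ) - 1 + 2 / Real.pi *
      (α + (α * rootXi lam + rootTheta lam * Real.log 4)) * L⌋₊ : ℕ) : ℝ) ≤
      simpleRootsBound α lam := by
  have hk₀ : 0 ≤ (k : ℝ) - 1 := sub_nonneg.2 (Nat.one_le_cast.2 hk)
  have hS := shortestPathLength_nonneg (Set.range lam)
  have hD := mul_rootXi_add_rootTheta_mul_log_nonneg hα lam
  set S := shortestPathLength (Set.range lam)
  set D := α * rootXi lam + rootTheta lam * Real.log 4 with hD_def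
  have hfloor : (⌊(k : ℝ) - 1 + 2 / Real.pi * (α + D) * L⌋₊ : ℝ) ≤
      (k : ℝ) - 1 + 2 / Real.pi * (α + D) * S :=
    (Nat.cast_le.2 (Nat.floor_mono (by gcongr))).trans (Nat.floor_le (by positivity))
  rw [simpleRootsBound, Nat.cast_mul, Nat.cast_pred hk]
  calc ((k : ℝ) - 1) * ⌊(k : ℝ) - 1 + 2 / Real.pi * (α + D) * L⌋₊
      ≤ ((k : ℝ) - 1) * ((k : ℝ) - 1 + 2 / Real.pi * (2 * α + D) * S) := by
        refine mul_le_mul_of_nonneg_left (hfloor.trans ?_) hk₀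
        gcongr
        linarith
    _ = ((k : ℝ) - 1) ^ 2 + 2 / Real.pi * ((k : ℝ) - 1) * S *
          (α * (rootXi lam + 2) + rootTheta lam * Real.log 4) := by
        rw [hD_def]
        ring

theorem zeroCount_le_floor_simpleRootsBound (hα : 0 ≤ α) (ha : a (Fin.last k) ≠ 0)
    (hlam : (odeCharPoly a).roots = Multiset.map lam Finset.univ.val)
    (hre : StrictMono fun j => (lam j).re) (hy : IsODESolution a y) (hne : y ≠ 0) :
    zeroCount y (horizontalStrip α) ≤ (⌊simpleRootsBound α lam⌋₊ : ℕ) := by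
  have hinj : Function.Injective lam := .of_comp hre.injective
  obtain ⟨c, hc⟩ := hy.exists_eq_sum_mul_exp ha hlam hinj
  have hc0 : c ≠ 0 := by
    rintro rfl
    exact hne (funext fun z => by simp [hc])
  obtain ⟨j, -⟩ := Function.ne_iff.1 hc0
  obtain ⟨p, hp, hlength⟩ := exists_list_polygonalLength_le_shortestPathLength
    (hlam ▸ Finset.univ.nodup.map hinj : (odeCharPoly a).roots.Nodup)
  refine (zeroCount_horizontalStrip_le (N := k - 1) (fun h => hne (congrArg Subtype.val h))
    (aeval_entireDeriv_list_prod_eq_zero ha hy hp) hα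
    (mul_rootXi_add_rootTheta_mul_log_nonneg hα lam) ?_).trans (Nat.cast_le.2 (Nat.le_floor ?_))
  · exact (reCoverable_zeros_of_strictMono_re hre hc0 α).mono
      (fun ζ ⟨hζ, h0⟩ => ⟨hζ, (hc ζ).symm.trans h0⟩) le_rfl le_rfl
  · rw [← Multiset.coe_card, hp, card_roots_odeCharPoly ha]
    exact mul_floor_le_simpleRootsBound hα (by have := j.pos; omega)
      (setOf_mem_roots_eq_range hlam ▸ hlength)

end ZeroBounds

theorem proposition1 (α : ℝ) (hα : 0 ≤ α) (k : ℕ) (a : Fin (k + 1) → ℂ) (ha : a (Fin.last k) ≠ 0)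
    (hroots : ∀ μ ∈ (odeCharPoly a).roots, ∀ ν ∈ (odeCharPoly a).roots, μ ≠ ν → μ.re ≠ ν.re) :
    ∃ N : ℕ,
      (∀ y : ℂ → ℂ, IsODESolution a y → y ≠ 0 → zeroCount y (horizontalStrip α) ≤ (N : ℕ∞)) ∧
      (∀ lam : Fin k → ℂ,
        (odeCharPoly a).roots = Multiset.map lam Finset.univ.val →
        StrictMono (fun j => (lam j).re) →
        (N : ℝ) ≤ ((k : ℝ) - 1) ^ 2 +
          2 / Real.pi * ((k : ℝ) - 1) * shortestPathLength {μ | μ ∈ (odeCharPoly a).roots} *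
            (α * (rootXi lam + 2) + rootTheta lam * Real.log 4)) := by
  classical
  have hfinite := exists_zeroCount_le hα ha fun μ hμ ν hν => not_imp_not.1 (hroots μ hμ ν hν)
  refine ⟨Nat.find hfinite, Nat.find_spec hfinite, fun lam hlam hre => ?_⟩
  rw [setOf_mem_roots_eq_range hlam]
  calc (Nat.find hfinite : ℝ) ≤ ⌊simpleRootsBound α lam⌋₊ :=
        Nat.cast_le.2 (Nat.find_min' hfinite fun y hy hne =>
          zeroCount_le_floor_simpleRootsBound hα ha hlam hre hy hne)
    _ ≤ simpleRootsBound α lam := Nat.floor_le (simpleRootsBound_nonneg hα lam)
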